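/- For integers $0\le \ell\le N$ let $$\mathbb H^{2N+1}_\ell=\Big\{(z,w)\in\mathbb C^N\times\mathbb C:\ \operatorname{Im} w=-\sum_{j=1}^{\ell}|z_j|^2+\sum_{j=\ell+1}^{N}|z_j|^2\Big\},$$ with defining function $\rho_{N,\ell}(Z,\bar Z)=\frac{w-\bar w}{2i}+\sum_{j\le \ell}z_j\bar z_j-\sum_{j>\ell}z_j\bar z_j$, $Z=(z,w)$. A formal embedding $H\colon(\mathbb H^{2n+1}_{\ell},0)\to(\mathbb H^{2N+1}_{\ell'},0)$ is an $(N+1)$-tuple of formal power series in $\mathbb C[\![z,w]\!]$, $(z,w)\in\mathbb C^n\times\mathbb C$, without constant terms, whose Jacobian matrix at $0$ has rank $n+1$, and which sends $\mathbb H^{2n+1}_\ell$ into $\mathbb H^{2N+1}_{\ell'}$ in the formal sense that $\rho_{N,\ell'}\big(H(Z),\overline{H(Z)}\big)=a(Z,\bar Z)\,\rho_{n,\ell}(Z,\bar Z)$ for some formal power series $a$. Let $\mathrm{Aut}(\mathbb H^{2N+1}_\ell,0)$ be the group of germs of local biholomorphisms $(\mathbb C^{N+1},0)\to(\mathbb C^{N+1},0)$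 that preserve $\mathbb H^{2N+1}_\ell$. **Theorem.** Let $n$ be even, let $0\le k<n$, and let $H\colon(\mathbb H^{2n+1}_{n/2},0)\to(\mathbb H^{2(n+k)+1}_{n/2},0)$ be a formal embedding. Then there exists $T\in\mathrm{Aut}(\mathbb H^{2(n+k)+1}_{n/2},0)$ such that the formal map $T\circ H$ (the Taylor series of $T$ at $0$ composed with $H$) is either the linear embedding $$L(z,w)=(z_1,\dots,z_n,0,w)$$ or the embedding $$L_-(z,w)=(z_{n/2+1},\dots,z_n,z_1,\dots,z_{n/2},0,-w),$$ where $0$ denotes the zero vector of $\mathbb C^k$. -/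

import Mathlib

open Filter Topology

noncomputable section

namespace Quadric

/-- Formal power series in the coordinates `(z, w) ∈ ℂⁿ × ℂ`. The index `j.castSucc`, for `j : Fin n`,
stands for `z_{j+1}`, and the index `Fin.last n` stands for `w`. -/
abbrev Series (n : ℕ) : Type := MvPowerSeries (Fin (n + 1)) ℂ

/-- Formal power series in `(Z, Z̄)`, with `Z = (z, w) ∈ ℂⁿ × ℂ`; `Sum.inl` indexes the variables `Z`
and `Sum.inr` the variables `Z̄`. -/
abbrev MixedSeries (n : ℕ) : Type := MvPowerSeries (Fin (n + 1) ⊕ Fin (n + 1)) ℂ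

/-- The sign of `|z_{j+1}|²` in the form of signature `ℓ`: the first `ℓ` squares are negative. -/
def sgn (ℓ j : ℕ) : ℝ := if j < ℓ then -1 else 1

/-- The hyperquadric `Im w = -∑_{j ≤ ℓ} |z_j|² + ∑_{j > ℓ} |z_j|²` in `ℂᴺ × ℂ`. -/
def quadric (N ℓ : ℕ) : Set (Fin (N + 1) → ℂ) :=
  {Z | (Z (Fin.last N)).im = ∑ j : Fin N, sgn ℓ j * ‖Z j.castSucc‖ ^ 2}

/-- The series `P(Z)`, viewed as a series in `(Z, Z̄)`. -/
def hol {n : ℕ} (P : Series n) : MixedSeries n :=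
  MvPowerSeries.rename Sum.inl P

/-- The complex conjugate of `P(Z)`: the conjugate coefficients, in the variables `Z̄`. -/
def conjHol {n : ℕ} (P : Series n) : MixedSeries n :=
  MvPowerSeries.rename Sum.inr (MvPowerSeries.map (starRingEnd ℂ) P)

/-- For a formal map `H = (F, G)` into `ℂᴺ × ℂ`, the series
`Im G + ∑_{j ≤ ℓ} |F_j|² - ∑_{j > ℓ} |F_j|²` in `(Z, Z̄)`: the defining function of the
hyperquadric of signature `ℓ`, composed with `H`. -/
def defining {n N : ℕ} (ℓ : ℕ) (H : Fin (N + 1) → Series n) : MixedSeries n :=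
  MvPowerSeries.C (1 / (2 * Complex.I)) * (hol (H (Fin.last N)) - conjHol (H (Fin.last N)))
    - ∑ j : Fin N, MvPowerSeries.C ((sgn ℓ j : ℝ) : ℂ)
        * (hol (H j.castSucc) * conjHol (H j.castSucc))

/-- The Jacobian matrix at `0` of a formal map. -/
def jacobian {n N : ℕ} (H : Fin (N + 1) → Series n) : Matrix (Fin (N + 1)) (Fin (n + 1)) ℂ :=
  Matrix.of fun i j => MvPowerSeries.coeff (Finsupp.single j 1) (H i)

/-- `H` is a formal holomorphic embedding of the hyperquadric of signature `ℓ` in `ℂⁿ × ℂ` into the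
one of signature `ℓ'` in `ℂᴺ × ℂ`, sending `0` to `0`. That `H` sends the first hyperquadric into
the second means, formally, that the defining function of the second, composed with `H`, is a
multiple of the defining function of the first in the ring of formal power series in `(Z, Z̄)`. -/
structure IsFormalEmbedding {n N : ℕ} (ℓ ℓ' : ℕ) (H : Fin (N + 1) → Series n) : Prop where
  map_zero : ∀ i, MvPowerSeries.constantCoeff (H i) = 0
  injective : Function.Injective fun v : Fin (n + 1) → ℂ => (jacobian H).mulVec v
  maps_quadric : defining ℓ (fun i : Fin (n + 1) => (MvPowerSeries.X i : Series n)) ∣ defining ℓ' H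

/-- (The germ at `0` of) `T` is a local biholomorphism of `(ℂᴺ × ℂ, 0)` that preserves the
hyperquadric of signature `ℓ`. -/
structure IsAut (N ℓ : ℕ) (T : (Fin (N + 1) → ℂ) → (Fin (N + 1) → ℂ)) : Prop where
  map_zero : T 0 = 0
  analyticAt : AnalyticAt ℂ T 0
  bijective : Function.Bijective (fderiv ℂ T 0)
  preserves : ∀ᶠ Z in 𝓝 (0 : Fin (N + 1) → ℂ), (Z ∈ quadric N ℓ ↔ T Z ∈ quadric N ℓ)

/-- The tuple of power series `P` is the Taylor series at `0` of the holomorphic map `T`: it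
converges to `T` near `0`. -/
def IsTaylorSeries {N : ℕ} (T : (Fin (N + 1) → ℂ) → (Fin (N + 1) → ℂ))
    (P : Fin (N + 1) → Series N) : Prop :=
  ∀ᶠ Z in 𝓝 (0 : Fin (N + 1) → ℂ), ∀ i,
    HasSum (fun d : Fin (N + 1) →₀ ℕ => MvPowerSeries.coeff d (P i) * ∏ m, Z m ^ d m) (T Z i)

/-- The composition `P ∘ H` of formal maps (`H` has no constant term). -/
def comp {n N : ℕ} (P : Fin (N + 1) → Series N) (H : Fin (N + 1) → Series n) :
    Fin (N + 1) → Series n :=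
  fun i => MvPowerSeries.subst H (P i)

/-- The linear embedding `(z, w) ↦ (z, 0, w)` of `ℂⁿ × ℂ` into `ℂⁿ⁺ᵏ × ℂ`. -/
def linL (n k : ℕ) : Fin (n + k + 1) → Series n :=
  Fin.snoc (α := fun _ => Series n)
    (fun j : Fin (n + k) =>
      if h : (j : ℕ) < n then MvPowerSeries.X (Fin.castSucc ⟨j, h⟩) else 0)
    (MvPowerSeries.X (Fin.last n))

/-- For `n = 2ℓ`, the embedding `(z, w) ↦ (z_{ℓ+1}, …, z_n, z_1, …, z_ℓ, 0, -w)`. -/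
def linLminus (n k : ℕ) : Fin (n + k + 1) → Series n :=
  Fin.snoc (α := fun _ => Series n)
    (fun j : Fin (n + k) =>
      if h : (j : ℕ) < n / 2 then
        MvPowerSeries.X (Fin.castSucc ⟨(j : ℕ) + n / 2, by omega⟩)
      else if h' : (j : ℕ) < n then
        MvPowerSeries.X (Fin.castSucc ⟨(j : ℕ) - n / 2, by omega⟩)
      else 0)
    (-MvPowerSeries.X (Fin.last n))

end Quadric

end

/-! In homogeneous coordinates the target quadric is the null cone of a nondegenerate Hermitian
form, and the map becomes Φ = (1 : H). Let v_α be the vector of Z^α-coefficients of Φ. The mapping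
equation then says that ⟨v_α, v_β⟩ is the (α, β) coefficient of a(Z, Z̄) ρ(Z, Z̄), so the problem
concerns vectors with a constrained Gram matrix.

Signature enters first. The number a(0, 0) is real, and it is nonzero because an isotropic space of
tangent directions cannot have dimension n > ℓ (`IsFormalEmbedding.mixedCoeff_ne_zero`). Let ε be
its sign. Multiplying Φ by a suitable unit series gives a(Z, 0) = ε. The coefficients of 1, of the
z_j (with the two halves exchanged if ε = -1), and ε times that of w, then have the Gram matrix of a
standard basis. Since ℓ is the same on both sides, their orthogonal complement is definite
(`IsFrame.form_self_neg`), and a unitary matrix carries them to standard basis vectors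
(`IsFrame.exists_isUnitary`). The map is now (p : f : φ : q) with q = εw, a standard 1-jet, and a
definite form on the normal part φ.

Linearity rests on the balance of signs. Summing the diagonal-type coefficients (γ + x₁w, γ + x₂w)
over |γ| = d and x₁ + x₂ = M kills every multiple of ρ when the signs sum to zero
(`sum_modelCoeff`). With M = 2m, and once the lower w-orders of φ and the contributions of p, q, f
vanish, what remains is a sum of squares of the coefficients of φ of w-order m, so these vanish too.
The bootstrap is: φ at w-order 0 gives f = z; this gives φ at w-order 1, which gives p = 1; then φ
vanishes at every order (`IsNormalized.φ_eq_zero`). The unitary matrix acts as a projective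
transformation, and this is the automorphism T. -/

namespace Quadric

/-! ### Rigidity of normalized maps, at the level of coefficients -/

section coefficients

open Finsupp

/-- The `(α, β)` coefficient of `A(Z, Z̄) * (c (w - w̄) - ∑ s_j z_j z̄_j)`, in terms of the
coefficients of `A`. -/
noncomputable def modelCoeff {n : ℕ} (c : ℂ) (s : Fin n → ℂ) (A : (Fin (n + 1) →₀ ℕ) → (Fin (n + 1) →₀ ℕ) → ℂ)
    (α β : Fin (n + 1) →₀ ℕ) : ℂ :=
  c * ((if single (Fin.last n) 1 ≤ α then A (α - single (Fin.last n) 1) β else 0)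
      - (if single (Fin.last n) 1 ≤ β then A α (β - single (Fin.last n) 1) else 0))
    - ∑ j : Fin n, s j * (if single j.castSucc 1 ≤ α ∧ single j.castSucc 1 ≤ β then
        A (α - single j.castSucc 1) (β - single j.castSucc 1) else 0)

/-- The exponents of the monomials of degree `d` in `z`. -/
noncomputable def zExponents (n d : ℕ) : Finset (Fin (n + 1) →₀ ℕ) :=
  (Finset.univ.erase (Fin.last n)).finsuppAntidiag d

lemma mem_zExponents {n d : ℕ} {γ : Fin (n + 1) →₀ ℕ} :
    γ ∈ zExponents n d ↔ γ (Fin.last n) = 0 ∧ γ.degree = d := by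
  have key : γ.degree = γ (Fin.last n) + ∑ i ∈ Finset.univ.erase (Fin.last n), γ i := by
    rw [Finsupp.degree_eq_sum, Finset.add_sum_erase _ _ (Finset.mem_univ _)]
  have : γ.support ⊆ Finset.univ.erase (Fin.last n) ↔ γ (Fin.last n) = 0 := by
    constructor
    · intro h
      by_contra h0
      simpa using h (Finsupp.mem_support_iff.2 h0)
    · intro h i hi
      rw [Finset.mem_erase]
      refine ⟨?_, Finset.mem_univ _⟩
      rintro rfl
      exact Finsupp.mem_support_iff.1 hi h
  rw [zExponents, Finset.mem_finsuppAntidiag, this, key]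
  constructor
  · rintro ⟨h1, h2⟩
    exact ⟨h2, by rw [h2, zero_add, ← h1]⟩
  · rintro ⟨h1, h2⟩
    exact ⟨by rw [← h2, h1, zero_add], h1⟩

lemma sum_zExponents_zero {n : ℕ} (j : Fin n) (F : (Fin (n + 1) →₀ ℕ) → ℂ) :
    ∑ γ ∈ zExponents n 0, (if single j.castSucc 1 ≤ γ then F (γ - single j.castSucc 1) else 0)
      = 0 := by
  refine Finset.sum_eq_zero fun γ hγ => if_neg fun h => ?_
  have h1 := (mem_zExponents.1 hγ).2
  rw [Finsupp.degree_eq_zero_iff] at h1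
  subst h1
  have := h j.castSucc
  simp at this

/-- Division by z_j maps the monomials of degree d + 1 divisible by z_j bijectively onto those of
degree d. The point is that the result does not depend on j. -/
lemma sum_zExponents_succ {n d : ℕ} (j : Fin n) (F : (Fin (n + 1) →₀ ℕ) → ℂ) :
    ∑ γ ∈ zExponents n (d + 1),
      (if single j.castSucc 1 ≤ γ then F (γ - single j.castSucc 1) else 0)
      = ∑ γ ∈ zExponents n d, F γ := by
  rw [← Finset.sum_filter]
  symm
  refine Finset.sum_nbij' (fun γ => γ + single j.castSucc 1) (fun γ => γ - single j.castSucc 1)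
    ?_ ?_ ?_ ?_ ?_
  · intro γ hγ
    rw [mem_zExponents] at hγ
    rw [Finset.mem_filter, mem_zExponents]
    refine ⟨⟨?_, ?_⟩, le_add_self⟩
    · simp [hγ.1]
    · rw [map_add, hγ.2, Finsupp.degree_single]
  · intro γ hγ
    rw [Finset.mem_filter, mem_zExponents] at hγ
    obtain ⟨δ, rfl⟩ := exists_add_of_le hγ.2
    rw [mem_zExponents, add_tsub_cancel_left]
    refine ⟨by simpa using hγ.1.1, ?_⟩
    have := hγ.1.2
    rw [map_add, Finsupp.degree_single] at this
    omega
  · intro γ _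
    simp
  · intro γ hγ
    exact tsub_add_cancel_of_le (Finset.mem_filter.1 hγ).2
  · intro γ _
    simp

lemma single_le_add_single_last {n : ℕ} (j : Fin n) (γ : Fin (n + 1) →₀ ℕ) (m : ℕ) :
    single j.castSucc 1 ≤ γ + single (Fin.last n) m ↔ single j.castSucc 1 ≤ γ := by
  have h : (γ + single (Fin.last n) m) j.castSucc = γ j.castSucc := by
    simp
  rw [Finsupp.single_le_iff, Finsupp.single_le_iff, h]

/-- Averaging over the exponents of a fixed degree kills the multiples of the defining function of
a hyperquadric with as many positive as negative squares. -/
lemma sum_modelCoeff {n : ℕ} (c : ℂ) {s : Fin n → ℂ} (hs : ∑ j, s j = 0)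
    (A : (Fin (n + 1) →₀ ℕ) → (Fin (n + 1) →₀ ℕ) → ℂ) (d M : ℕ) :
    ∑ γ ∈ zExponents n d, ∑ x ∈ Finset.HasAntidiagonal.antidiagonal M,
      modelCoeff c s A (γ + single (Fin.last n) x.1) (γ + single (Fin.last n) x.2) = 0 := by
  -- The w and w̄ terms cancel: after a shift, each is the sum of A over pairs of w-orders with
  -- total M - 1.
  have hw : ∀ γ ∈ zExponents n d, ∑ x ∈ Finset.HasAntidiagonal.antidiagonal M,
      ((if single (Fin.last n) 1 ≤ γ + single (Fin.last n) x.1 then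
          A (γ + single (Fin.last n) x.1 - single (Fin.last n) 1) (γ + single (Fin.last n) x.2)
          else 0)
        - (if single (Fin.last n) 1 ≤ γ + single (Fin.last n) x.2 then
          A (γ + single (Fin.last n) x.1) (γ + single (Fin.last n) x.2 - single (Fin.last n) 1)
          else 0)) = 0 := by
    intro γ hγ
    have h0 := (mem_zExponents.1 hγ).1
    have hle : ∀ m, single (Fin.last n) 1 ≤ γ + single (Fin.last n) m ↔ 1 ≤ m := by
      intro m
      rw [Finsupp.single_le_iff]
      simp [h0]
    have hsub : ∀ m, γ + (single (Fin.last n) m + single (Fin.last n) 1) - single (Fin.last n) 1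
        = γ + single (Fin.last n) m := by
      intro m
      rw [← add_assoc, add_tsub_cancel_right]
    simp only [hle]
    rw [Finset.sum_sub_distrib]
    cases M with
    | zero => simp
    | succ M =>
      rw [Finset.Nat.sum_antidiagonal_succ, Finset.Nat.sum_antidiagonal_succ']
      simp [hsub]
  have hz : ∀ x ∈ Finset.HasAntidiagonal.antidiagonal M, ∑ γ ∈ zExponents n d, ∑ j : Fin n,
      s j * (if single j.castSucc 1 ≤ γ + single (Fin.last n) x.1 ∧
        single j.castSucc 1 ≤ γ + single (Fin.last n) x.2 then
        A (γ + single (Fin.last n) x.1 - single j.castSucc 1)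
          (γ + single (Fin.last n) x.2 - single j.castSucc 1) else 0) = 0 := by
    intro x _
    rw [Finset.sum_comm]
    obtain ⟨F, hF⟩ : ∃ F : (Fin (n + 1) →₀ ℕ) → ℂ, ∀ δ, F δ =
      A (δ + single (Fin.last n) x.1) (δ + single (Fin.last n) x.2) := ⟨_, fun _ => rfl⟩
    have : ∀ j : Fin n, ∀ γ : Fin (n + 1) →₀ ℕ,
        (if single j.castSucc 1 ≤ γ + single (Fin.last n) x.1 ∧
          single j.castSucc 1 ≤ γ + single (Fin.last n) x.2 then
          A (γ + single (Fin.last n) x.1 - single j.castSucc 1)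
            (γ + single (Fin.last n) x.2 - single j.castSucc 1) else 0)
        = if single j.castSucc 1 ≤ γ then F (γ - single j.castSucc 1) else 0 := by
      intro j γ
      simp only [single_le_add_single_last, and_self, hF]
      split_ifs with h
      · rw [tsub_add_eq_add_tsub h, tsub_add_eq_add_tsub h]
      · rfl
    simp only [this, ← Finset.mul_sum]
    cases d with
    | zero => simp only [sum_zExponents_zero, mul_zero, Finset.sum_const_zero]
    | succ d => simp only [sum_zExponents_succ, ← Finset.sum_mul, hs, zero_mul]
  simp only [modelCoeff]
  simp only [Finset.sum_sub_distrib, ← Finset.mul_sum]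
  rw [Finset.sum_comm (s := zExponents n d) (t := Finset.HasAntidiagonal.antidiagonal M)
    (f := fun γ x => ∑ j : Fin n, _), Finset.sum_eq_zero hz, sub_zero]
  have h2 := Finset.sum_eq_zero hw
  simp only [Finset.sum_sub_distrib] at h2
  rw [h2, mul_zero]

/-- Coefficients of a formal map `(p : f : φ : q)` between hyperquadrics in homogeneous coordinates,
with standard `1`-jet, scaled so that `q = w`. Its defining equation has the coefficients of the
multiple `A(Z, Z̄) * (c (w - w̄) - ∑ s_j z_j z̄_j)`. -/
structure IsNormalized {n : ℕ} {ι : Type*} [Fintype ι] (c : ℂ) (s : Fin n → ℂ)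
    (p q : (Fin (n + 1) →₀ ℕ) → ℂ) (f : Fin n → (Fin (n + 1) →₀ ℕ) → ℂ)
    (φ : ι → (Fin (n + 1) →₀ ℕ) → ℂ)
    (A : (Fin (n + 1) →₀ ℕ) → (Fin (n + 1) →₀ ℕ) → ℂ) : Prop where
  c_ne : c ≠ 0
  s_ne : ∀ j, s j ≠ 0
  sum_s : ∑ j, s j = 0
  q_eq : ∀ α, q α = if α = single (Fin.last n) 1 then 1 else 0
  p_zero : p 0 = 1
  p_single : ∀ i, p (single i 1) = 0
  f_zero : ∀ j, f j 0 = 0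
  f_single : ∀ j i, f j (single i 1) = if i = Fin.castSucc j then 1 else 0
  φ_zero : ∀ i, φ i 0 = 0
  φ_single : ∀ i j, φ i (single j 1) = 0
  eqn : ∀ α β, c * (q α * star (p β) - p α * star (q β)) - ∑ j, s j * (f j α * star (f j β))
    - ∑ i, φ i α * star (φ i β) = modelCoeff c s A α β

namespace IsNormalized

variable {n : ℕ} {ι : Type*} [Fintype ι] {c : ℂ} {s : Fin n → ℂ}
  {p q : (Fin (n + 1) →₀ ℕ) → ℂ} {f : Fin n → (Fin (n + 1) →₀ ℕ) → ℂ}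
  {φ : ι → (Fin (n + 1) →₀ ℕ) → ℂ} {A : (Fin (n + 1) →₀ ℕ) → (Fin (n + 1) →₀ ℕ) → ℂ}

lemma q_zero (h : IsNormalized c s p q f φ A) : q 0 = 0 := by
  rw [h.q_eq, if_neg]
  intro h0
  simpa using (Finsupp.single_eq_zero.1 h0.symm)

/-- At Z̄ = 0 the equation reads c q = c w A(Z, 0), so the normalization q = w amounts to A(Z, 0) =
1. -/
lemma coeff_zero (h : IsNormalized c s p q f φ A) (α : Fin (n + 1) →₀ ℕ) :
    A α 0 = if α = 0 then 1 else 0 := by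
  have h1 := h.eqn (α + single (Fin.last n) 1) 0
  simp only [h.p_zero, h.q_zero, h.f_zero, h.φ_zero, modelCoeff, star_zero, mul_zero, star_one,
    mul_one, sub_zero, Finset.sum_const_zero, le_add_self, if_true, add_tsub_cancel_right] at h1
  have hne : ∀ i : Fin (n + 1), ¬ (single i 1 ≤ (0 : Fin (n + 1) →₀ ℕ)) := by
    intro i hi
    have := hi i
    simp at this
  simp only [hne, and_false, if_false, mul_zero, Finset.sum_const_zero, sub_zero] at h1
  rw [← mul_left_cancel₀ h.c_ne h1, h.q_eq]
  simp only [add_eq_right]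

lemma single_le_single {σ : Type*} [DecidableEq σ] (i j : σ) :
    (single i 1 : σ →₀ ℕ) ≤ single j 1 ↔ i = j := by
  rw [Finsupp.single_le_iff, Finsupp.single_apply]
  split_ifs with h
  · simp [h]
  · simp [Ne.symm h]

/-- The z̄_r coefficient of the equation isolates f_r, since the 1-jets of p, q and φ contain no
z_r. Thus f_r is z_r up to w times a coefficient of A; in particular it is known modulo w. -/
lemma f_eq (h : IsNormalized c s p q f φ A) (r : Fin n) (α : Fin (n + 1) →₀ ℕ) :
    s r * f r α = s r * (if α = single r.castSucc 1 then 1 else 0) -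
      c * (if single (Fin.last n) 1 ≤ α then
        A (α - single (Fin.last n) 1) (single r.castSucc 1) else 0) := by
  have h1 := h.eqn α (single r.castSucc 1)
  have hq : q (single r.castSucc 1) = 0 := by
    rw [h.q_eq, if_neg]
    intro h0
    have := (Finsupp.single_left_inj one_ne_zero).1 h0
    exact (Fin.castSucc_lt_last r).ne this
  simp only [h.p_single, h.f_single, h.φ_single, hq, modelCoeff, star_zero, mul_zero,
    sub_zero, Finset.sum_const_zero, zero_sub, Fin.castSucc_inj, single_le_single,
    (Fin.castSucc_lt_last r).ne'] at h1
  rw [Finset.sum_eq_single r (by intro b _ hb; simp [hb.symm]) (by simp),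
    Finset.sum_eq_single r (by intro b _ hb; simp [hb]) (by simp)] at h1
  simp only [if_true, star_one, mul_one, if_false, sub_zero, and_true, tsub_self,
    h.coeff_zero] at h1
  have h2 : (if single r.castSucc 1 ≤ α then if α - single r.castSucc 1 = 0 then (1 : ℂ) else 0
      else 0) = if α = single r.castSucc 1 then 1 else 0 := by
    by_cases hα : single r.castSucc 1 ≤ α
    · rw [if_pos hα]
      congr 1
      rw [tsub_eq_zero_iff_le]
      exact propext ⟨fun h3 => le_antisymm h3 hα, fun h3 => h3.le⟩
    · rw [if_neg hα, if_neg]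
      rintro rfl
      exact hα le_rfl
  rw [h2] at h1
  linear_combination -h1

/-- Likewise the w̄ coefficient isolates p, because w occurs in the 1-jet of q only. -/
lemma p_eq (h : IsNormalized c s p q f φ A) (α : Fin (n + 1) →₀ ℕ) :
    p α = (if α = 0 then 1 else 0) -
      (if single (Fin.last n) 1 ≤ α then
        A (α - single (Fin.last n) 1) (single (Fin.last n) 1) else 0) := by
  have h1 := h.eqn α (single (Fin.last n) 1)
  simp only [h.p_single, h.f_single, h.φ_single, h.q_eq (single (Fin.last n) 1), modelCoeff,
    star_zero, mul_zero, Finset.sum_const_zero, zero_sub, single_le_single, le_refl, if_true,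
    (Fin.castSucc_lt_last _).ne, (Fin.castSucc_lt_last _).ne', if_false, and_false, sub_zero,
    star_one, mul_one, tsub_self, h.coeff_zero] at h1
  linear_combination -(mul_left_cancel₀ h.c_ne h1)

lemma p_of_last_eq_zero (h : IsNormalized c s p q f φ A) {α : Fin (n + 1) →₀ ℕ}
    (hα : α (Fin.last n) = 0) : p α = if α = 0 then 1 else 0 := by
  rw [h.p_eq, if_neg (c := single (Fin.last n) 1 ≤ α), sub_zero]
  rw [Finsupp.single_le_iff, hα]
  simp

lemma q_of_last_eq_zero (h : IsNormalized c s p q f φ A) {α : Fin (n + 1) →₀ ℕ}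
    (hα : α (Fin.last n) = 0) : q α = 0 := by
  rw [h.q_eq, if_neg]
  rintro rfl
  simp at hα

lemma f_of_last_eq_zero (h : IsNormalized c s p q f φ A) {α : Fin (n + 1) →₀ ℕ}
    (hα : α (Fin.last n) = 0) (r : Fin n) :
    f r α = if α = single r.castSucc 1 then 1 else 0 := by
  refine mul_left_cancel₀ (h.s_ne r) ?_
  rw [h.f_eq, if_neg (c := single (Fin.last n) 1 ≤ α), mul_zero, sub_zero]
  rw [Finsupp.single_le_iff, hα]
  simp

/-- If the coefficients of order `< m` in `w` of `φ` vanish, and those of total order `2 m` of the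
other terms of the equation, then so do the coefficients of order `m` of `φ`. -/
lemma φ_eq_zero_of_lt (h : IsNormalized c s p q f φ A) (m d : ℕ)
    (hlt : ∀ m' < m, ∀ γ ∈ zExponents n d, ∀ i, φ i (γ + single (Fin.last n) m') = 0)
    (hvan : ∀ γ ∈ zExponents n d, ∀ x ∈ Finset.HasAntidiagonal.antidiagonal (2 * m),
      c * (q (γ + single (Fin.last n) x.1) * star (p (γ + single (Fin.last n) x.2))
        - p (γ + single (Fin.last n) x.1) * star (q (γ + single (Fin.last n) x.2)))
      - ∑ j, s j * (f j (γ + single (Fin.last n) x.1) * star (f j (γ + single (Fin.last n) x.2)))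
      = 0)
    {γ : Fin (n + 1) →₀ ℕ} (hγ : γ ∈ zExponents n d) (i : ι) :
    φ i (γ + single (Fin.last n) m) = 0 := by
  have h1 := sum_modelCoeff c h.sum_s A d (2 * m)
  have h2 : ∀ γ ∈ zExponents n d, ∑ x ∈ Finset.HasAntidiagonal.antidiagonal (2 * m),
      modelCoeff c s A (γ + single (Fin.last n) x.1) (γ + single (Fin.last n) x.2)
      = - ((∑ i, ‖φ i (γ + single (Fin.last n) m)‖ ^ 2 : ℝ) : ℂ) := by
    intro γ hγ
    -- In a pair (a, b) ≠ (m, m) with a + b = 2m one index is below m, so that factor of φ vanishes.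
    -- Only the squared norms at (m, m) survive.
    rw [Finset.sum_eq_single (m, m)]
    · rw [← h.eqn, hvan γ hγ (m, m) (by simp; omega), zero_sub]
      push_cast
      congr 1
      refine Finset.sum_congr rfl fun i _ => ?_
      exact RCLike.mul_conj _
    · rintro ⟨a, b⟩ hab hne
      rw [← h.eqn, hvan γ hγ _ hab, zero_sub, neg_eq_zero]
      refine Finset.sum_eq_zero fun i _ => ?_
      rw [Finset.HasAntidiagonal.mem_antidiagonal] at hab
      simp only at hab ⊢
      rcases lt_trichotomy a m with h3 | h3 | h3
      · rw [hlt a h3 γ hγ, zero_mul]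
      · exact absurd (Prod.ext h3 (by simp only; omega)) hne
      · rw [hlt b (by omega) γ hγ, star_zero, mul_zero]
    · intro h3
      exact absurd (by simp; omega) h3
  rw [Finset.sum_congr rfl h2, Finset.sum_neg_distrib, neg_eq_zero, ← Complex.ofReal_sum,
    Complex.ofReal_eq_zero, Finset.sum_eq_zero_iff_of_nonneg
      (fun _ _ => Finset.sum_nonneg fun _ _ => by positivity)] at h1
  have h4 := (Finset.sum_eq_zero_iff_of_nonneg (fun _ _ => by positivity)).1 (h1 γ hγ) i
    (Finset.mem_univ i)
  simpa using h4

lemma add_single_eq_single {γ : Fin (n + 1) →₀ ℕ} (hγ : γ (Fin.last n) = 0) {m : ℕ} {i : Fin n}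
    (h : γ + single (Fin.last n) m = single i.castSucc 1) : m = 0 := by
  have := DFunLike.congr_fun h (Fin.last n)
  simpa [hγ, (Fin.castSucc_lt_last i).ne, (Fin.castSucc_lt_last i).ne'] using this

lemma add_single_eq_last {γ : Fin (n + 1) →₀ ℕ} (hγ : γ (Fin.last n) = 0) {m : ℕ}
    (h : γ + single (Fin.last n) m = single (Fin.last n) 1) : γ = 0 ∧ m = 1 := by
  have h1 := DFunLike.congr_fun h (Fin.last n)
  have h2 : m = 1 := by simpa [hγ] using h1
  subst h2
  exact ⟨by simpa using h, rfl⟩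

/-- Start of the bootstrap: modulo w, p = 1, q = 0 and f = z are known. Outside degree one they
contribute nothing to the averaged equation; in degree one φ vanishes by its 1-jet. -/
lemma φ_of_last_eq_zero (h : IsNormalized c s p q f φ A) {γ : Fin (n + 1) →₀ ℕ}
    (hγ : γ (Fin.last n) = 0) (i : ι) : φ i γ = 0 := by
  by_cases hs : ∃ j : Fin n, γ = single j.castSucc 1
  · obtain ⟨j, rfl⟩ := hs
    exact h.φ_single i _
  have := h.φ_eq_zero_of_lt 0 γ.degree (by simp) ?_ (mem_zExponents.2 ⟨hγ, rfl⟩) i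
  · simpa using this
  · intro δ hδ x hx
    rw [mem_zExponents] at hδ
    have hne : ∀ j : Fin n, δ ≠ single j.castSucc 1 := by
      rintro j rfl
      have h1 : γ.degree = 1 := by rw [← hδ.2, Finsupp.degree_single]
      obtain ⟨a, ha⟩ := (Finsupp.sum_eq_one_iff γ).1 h1
      induction a using Fin.lastCases with
      | last => subst ha; simp at hγ
      | cast a => exact hs ⟨a, ha⟩
    have hx' : x = (0, 0) := by simpa using hx
    subst hx'
    simp [h.q_of_last_eq_zero hδ.1, h.f_of_last_eq_zero hδ.1, hne]

lemma axis_apply_last (r : Fin n) (m : ℕ) :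
    (single r.castSucc m : Fin (n + 1) →₀ ℕ) (Fin.last n) = 0 := by
  simp [(Fin.castSucc_lt_last r).ne]

lemma add_single_ne_last (r : Fin n) (m l : ℕ) (α : Fin (n + 1) →₀ ℕ) :
    α + single r.castSucc (m + 1) ≠ single (Fin.last n) l := by
  intro h0
  have := DFunLike.congr_fun h0 r.castSucc
  simp at this

/-- The recursion for the coefficients of `A` along an axis. -/
lemma modelCoeff_axis (c : ℂ) (s : Fin n → ℂ)
    (A : (Fin (n + 1) →₀ ℕ) → (Fin (n + 1) →₀ ℕ) → ℂ) (r : Fin n)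
    (α β : Fin (n + 1) →₀ ℕ) (hβ : ∀ j ≠ r, β j.castSucc = 0) :
    modelCoeff c s A (α + single r.castSucc 1) (β + single r.castSucc 1)
      = c * ((if single (Fin.last n) 1 ≤ α then
            A (α - single (Fin.last n) 1 + single r.castSucc 1) (β + single r.castSucc 1) else 0)
          - (if single (Fin.last n) 1 ≤ β then A (α + single r.castSucc 1)
            (β - single (Fin.last n) 1 + single r.castSucc 1) else 0))
        - s r * A α β := by
  have hle : ∀ δ : Fin (n + 1) →₀ ℕ, single (Fin.last n) 1 ≤ δ + single r.castSucc 1 ↔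
      single (Fin.last n) 1 ≤ δ := by
    intro δ
    rw [Finsupp.single_le_iff, Finsupp.single_le_iff, Finsupp.add_apply, axis_apply_last, add_zero]
  have hsub : ∀ δ : Fin (n + 1) →₀ ℕ, single (Fin.last n) 1 ≤ δ →
      δ + single r.castSucc 1 - single (Fin.last n) 1
        = δ - single (Fin.last n) 1 + single r.castSucc 1 := by
    intro δ hδ
    rw [tsub_add_eq_add_tsub hδ]
  rw [modelCoeff, Finset.sum_eq_single r]
  · simp only [hle, le_add_self, and_self, if_true, add_tsub_cancel_right]
    congr 3
    · split_ifs with h1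
      · rw [hsub _ h1]
      · rfl
    · split_ifs with h1
      · rw [hsub _ h1]
      · rfl
  · intro j _ hj
    rw [if_neg, mul_zero]
    rintro ⟨_, h2⟩
    rw [Finsupp.single_le_iff, Finsupp.add_apply, hβ j hj, Finsupp.single_apply, if_neg] at h2
    · simp at h2
    · rw [Fin.castSucc_inj]
      exact Ne.symm hj
  · simp

/-- Against z̄_r^(m+2) the left side of the equation vanishes, since all components are known modulo
w and none contains that power. On the right only the r-th square divides it, which gives a
recursion lowering the w-order of α. -/
lemma coeff_axis_eq_zero (h : IsNormalized c s p q f φ A) (r : Fin n) (α : Fin (n + 1) →₀ ℕ)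
    (m : ℕ) : A α (single r.castSucc (m + 1)) = 0 := by
  obtain ⟨l, hl⟩ : ∃ l, α (Fin.last n) = l := ⟨_, rfl⟩
  induction l generalizing α m with
  | zero => ?_
  | succ l ih => ?_
  all_goals
    have hax := axis_apply_last r (m + 2)
    have h1 := h.eqn (α + single r.castSucc 1) (single r.castSucc (m + 2))
    have h0 : (single r.castSucc (m + 2) : Fin (n + 1) →₀ ℕ) ≠ 0 := by simp
    have h2 : ∀ j : Fin n, (single r.castSucc (m + 2) : Fin (n + 1) →₀ ℕ)
        ≠ single j.castSucc 1 := by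
      intro j hj
      have := congrArg Finsupp.degree hj
      simp at this
    have h3 : ¬ (single (Fin.last n) 1 ≤ (single r.castSucc (m + 1) : Fin (n + 1) →₀ ℕ)) := by
      rw [Finsupp.single_le_iff, axis_apply_last]
      simp
    rw [h.q_of_last_eq_zero hax, h.p_of_last_eq_zero hax, if_neg h0] at h1
    simp only [h.φ_of_last_eq_zero hax, h.f_of_last_eq_zero hax, h2, if_false, star_zero, mul_zero,
      Finset.sum_const_zero, sub_zero] at h1
    rw [show (single r.castSucc (m + 2) : Fin (n + 1) →₀ ℕ)
      = single r.castSucc (m + 1) + single r.castSucc 1 by rw [← Finsupp.single_add],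
      modelCoeff_axis c s A r _ _ (by
        intro j hj
        rw [Finsupp.single_apply, if_neg]
        rw [Fin.castSucc_inj]; exact Ne.symm hj), if_neg h3, sub_zero] at h1
  · rw [if_neg (by rw [Finsupp.single_le_iff, hl]; simp), mul_zero, zero_sub, eq_comm,
      neg_eq_zero] at h1
    exact (mul_eq_zero.1 h1).resolve_left (h.s_ne r)
  · have h4 : single (Fin.last n) 1 ≤ α := by
      rw [Finsupp.single_le_iff, hl]; simp
    rw [if_pos h4, ← Finsupp.single_add, ih, mul_zero, zero_sub, eq_comm, neg_eq_zero] at h1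
    · exact (mul_eq_zero.1 h1).resolve_left (h.s_ne r)
    · simp [hl, (Fin.castSucc_lt_last r).ne]

lemma f_eq_single (h : IsNormalized c s p q f φ A) (r : Fin n) (α : Fin (n + 1) →₀ ℕ) :
    f r α = if α = single r.castSucc 1 then 1 else 0 := by
  refine mul_left_cancel₀ (h.s_ne r) ?_
  rw [h.f_eq, h.coeff_axis_eq_zero r _ 0]
  simp

/-- The averaging argument at total w-order 2. The terms in f have w-order 0, and the only possible
terms in p and q pair w with the w-coefficient of p, which is zero. -/
lemma φ_add_single_one (h : IsNormalized c s p q f φ A) {γ : Fin (n + 1) →₀ ℕ}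
    (hγ : γ (Fin.last n) = 0) (i : ι) : φ i (γ + single (Fin.last n) 1) = 0 := by
  refine h.φ_eq_zero_of_lt 1 γ.degree ?_ ?_ (mem_zExponents.2 ⟨hγ, rfl⟩) i
  · intro m hm δ hδ i
    rw [mem_zExponents] at hδ
    refine h.φ_of_last_eq_zero ?_ i
    simp [hδ.1]
    omega
  · rintro δ hδ ⟨a, b⟩ hab
    rw [mem_zExponents] at hδ
    rw [Finset.HasAntidiagonal.mem_antidiagonal] at hab
    simp only at hab
    have e1 : q (δ + single (Fin.last n) a) * star (p (δ + single (Fin.last n) b)) = 0 := by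
      rw [h.q_eq]
      split_ifs with h1
      · obtain ⟨rfl, rfl⟩ := add_single_eq_last hδ.1 h1
        obtain rfl : b = 1 := by omega
        rw [zero_add, h.p_single, star_zero, mul_zero]
      · rw [zero_mul]
    have e2 : p (δ + single (Fin.last n) a) * star (q (δ + single (Fin.last n) b)) = 0 := by
      rw [h.q_eq]
      split_ifs with h1
      · obtain ⟨rfl, rfl⟩ := add_single_eq_last hδ.1 h1
        obtain rfl : a = 1 := by omega
        rw [zero_add, h.p_single, zero_mul]
      · rw [star_zero, mul_zero]
    rw [e1, e2, sub_zero, mul_zero, zero_sub, neg_eq_zero]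
    refine Finset.sum_eq_zero fun j _ => ?_
    rw [h.f_eq_single, h.f_eq_single]
    split_ifs with h1 h2
    · have := add_single_eq_single hδ.1 h1
      have := add_single_eq_single hδ.1 h2
      omega
    all_goals simp

/-- The axis recursion with an extra factor w̄. The coefficient of p at the right-hand exponent is
not yet known, but it is multiplied by a coefficient of q at an exponent divisible by z_r, which is
zero. The case m = 0 is what determines p. -/
lemma coeff_axis_add_last_eq_zero (h : IsNormalized c s p q f φ A) (r : Fin n)
    (α : Fin (n + 1) →₀ ℕ) (m : ℕ) :
    A α (single r.castSucc m + single (Fin.last n) 1) = 0 := by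
  obtain ⟨l, hl⟩ : ∃ l, α (Fin.last n) = l := ⟨_, rfl⟩
  induction l generalizing α m with
  | zero => ?_
  | succ l ih => ?_
  all_goals
    have hax := axis_apply_last r (m + 1)
    have h1 := h.eqn (α + single r.castSucc 1) (single r.castSucc (m + 1) + single (Fin.last n) 1)
    have h0 : q (single r.castSucc (m + 1) + single (Fin.last n) 1) = 0 := by
      rw [h.q_eq, if_neg]
      exact fun h3 => add_single_ne_last r m 1 _ ((add_comm _ _).trans h3)
    have h0' : q (α + single r.castSucc 1) = 0 := by
      rw [h.q_eq, if_neg]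
      exact add_single_ne_last r 0 1 _
    have h2 : ∀ j : Fin n, (single r.castSucc (m + 1) + single (Fin.last n) 1
        : Fin (n + 1) →₀ ℕ) ≠ single j.castSucc 1 := by
      intro j hj
      have := congrArg Finsupp.degree hj
      simp at this
    rw [h0, h0'] at h1
    simp only [h.φ_add_single_one hax, h.f_eq_single, h2, if_false, star_zero, mul_zero,
      zero_mul, Finset.sum_const_zero, sub_zero] at h1
    rw [show (single r.castSucc (m + 1) + single (Fin.last n) 1 : Fin (n + 1) →₀ ℕ)
      = single r.castSucc m + single (Fin.last n) 1 + single r.castSucc 1 by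
        rw [Finsupp.single_add]; abel,
      modelCoeff_axis c s A r _ _ (by
        intro j hj
        rw [Finsupp.add_apply, Finsupp.single_apply, Finsupp.single_apply,
          if_neg (Fin.castSucc_lt_last j).ne', if_neg fun h3 => hj (Fin.castSucc_inj.1 h3).symm, add_zero]),
      if_pos (le_add_self),
      add_tsub_cancel_right, ← Finsupp.single_add, h.coeff_axis_eq_zero, sub_zero] at h1
  · rw [if_neg (by rw [Finsupp.single_le_iff, hl]; simp), mul_zero, zero_sub, eq_comm,
      neg_eq_zero] at h1
    exact (mul_eq_zero.1 h1).resolve_left (h.s_ne r)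
  · have h4 : single (Fin.last n) 1 ≤ α := by
      rw [Finsupp.single_le_iff, hl]; simp
    rw [if_pos h4, add_right_comm, ← Finsupp.single_add, ih, mul_zero, zero_sub, eq_comm,
      neg_eq_zero] at h1
    · exact (mul_eq_zero.1 h1).resolve_left (h.s_ne r)
    · simp [hl, (Fin.castSucc_lt_last r).ne]

lemma p_eq_single (h : IsNormalized c s p q f φ A) (hn : 0 < n) (α : Fin (n + 1) →₀ ℕ) :
    p α = if α = 0 then 1 else 0 := by
  have := h.coeff_axis_add_last_eq_zero ⟨0, hn⟩ (α - single (Fin.last n) 1) 0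
  rw [Finsupp.single_zero, zero_add] at this
  rw [h.p_eq, this]
  simp

lemma φ_eq_zero (h : IsNormalized c s p q f φ A) (hn : 0 < n) (i : ι) (α : Fin (n + 1) →₀ ℕ) :
    φ i α = 0 := by
  obtain ⟨γ, m, hγ, rfl⟩ : ∃ (γ : Fin (n + 1) →₀ ℕ) (m : ℕ), γ (Fin.last n) = 0 ∧
      α = γ + single (Fin.last n) m := by
    refine ⟨α.erase (Fin.last n), α (Fin.last n), by simp, ?_⟩
    exact (Finsupp.erase_add_single _ _).symm
  induction m using Nat.strong_induction_on generalizing γ i with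
  | _ m ih =>
    rcases Nat.eq_zero_or_pos m with rfl | hm
    · rw [Finsupp.single_zero, add_zero]
      exact h.φ_of_last_eq_zero hγ i
    refine h.φ_eq_zero_of_lt m γ.degree (fun m' hm' δ hδ i => ih m' hm' i δ
      (mem_zExponents.1 hδ).1) ?_ (mem_zExponents.2 ⟨hγ, rfl⟩) i
    rintro δ hδ ⟨a, b⟩ hab
    rw [mem_zExponents] at hδ
    rw [Finset.HasAntidiagonal.mem_antidiagonal] at hab
    simp only at hab
    -- With p = 1 and q = w, a nonzero product would have total w-order 1, which is not even.
    have e : ∀ a b : ℕ, a + b = 2 * m →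
        q (δ + single (Fin.last n) a) * star (p (δ + single (Fin.last n) b)) = 0 := by
      intro a b hab
      rw [h.q_eq, h.p_eq_single hn]
      split_ifs with h1 h2
      · obtain ⟨rfl, rfl⟩ := add_single_eq_last hδ.1 h1
        have : b = 0 := by simpa using h2
        omega
      all_goals simp
    have e2 : p (δ + single (Fin.last n) a) * star (q (δ + single (Fin.last n) b)) = 0 := by
      simpa [or_comm] using congrArg star (e b a (by omega))
    rw [e a b hab, e2, sub_zero, mul_zero, zero_sub, neg_eq_zero]
    refine Finset.sum_eq_zero fun j _ => ?_
    rw [h.f_eq_single, h.f_eq_single]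
    split_ifs with h1 h2
    · have := add_single_eq_single hδ.1 h1
      have := add_single_eq_single hδ.1 h2
      omega
    all_goals simp

end IsNormalized

end coefficients

/-! ### The Hermitian form and its unitary matrices -/

/-- The Hermitian form of the quadric of signature `ℓ` in homogeneous coordinates `(p : z : q)` of
projective space, with `p` at the index `none` and `q` at the index of `w`. -/
noncomputable def form {N : ℕ} (ℓ : ℕ) (x y : Option (Fin (N + 1)) → ℂ) : ℂ :=
  1 / (2 * Complex.I) * (x (some (Fin.last N)) * star (y none)
      - x none * star (y (some (Fin.last N))))
    - ∑ j : Fin N, ((sgn ℓ j : ℝ) : ℂ) * (x (some j.castSucc) * star (y (some j.castSucc)))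

section form

variable {N : ℕ} (ℓ : ℕ)

lemma star_half_I : star (1 / (2 * Complex.I)) = -(1 / (2 * Complex.I)) := by
  simp

lemma star_form (x y : Option (Fin (N + 1)) → ℂ) : star (form ℓ x y) = form ℓ y x := by
  simp only [form, star_sub, star_mul', star_half_I, star_star, star_sum]
  congr 1
  · ring
  · refine Finset.sum_congr rfl fun j _ => ?_
    rw [show star ((sgn ℓ j : ℝ) : ℂ) = ((sgn ℓ j : ℝ) : ℂ) from Complex.conj_ofReal _]
    ring

/-- The form as a linear functional in its first argument. -/
noncomputable def formLinear (y : Option (Fin (N + 1)) → ℂ) :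
    (Option (Fin (N + 1)) → ℂ) →ₗ[ℂ] ℂ where
  toFun x := form ℓ x y
  map_add' x x' := by
    simp only [form, Pi.add_apply, add_mul, mul_add, Finset.sum_add_distrib]
    ring
  map_smul' a x := by
    simp only [form, Pi.smul_apply, smul_eq_mul, RingHom.id_apply, mul_sub, Finset.mul_sum]
    congr 1
    · ring
    · exact Finset.sum_congr rfl fun j _ => by ring

lemma form_sum_left {ι : Type*} (t : Finset ι) (a : ι → ℂ)
    (v : ι → Option (Fin (N + 1)) → ℂ) (y : Option (Fin (N + 1)) → ℂ) :
    form ℓ (∑ i ∈ t, a i • v i) y = ∑ i ∈ t, a i * form ℓ (v i) y := by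
  change formLinear ℓ y _ = ∑ i ∈ t, a i * formLinear ℓ y (v i)
  rw [map_sum]
  simp only [map_smul, smul_eq_mul]

lemma form_sum_right {ι : Type*} (t : Finset ι) (a : ι → ℂ)
    (v : ι → Option (Fin (N + 1)) → ℂ) (x : Option (Fin (N + 1)) → ℂ) :
    form ℓ x (∑ i ∈ t, a i • v i) = ∑ i ∈ t, star (a i) * form ℓ x (v i) := by
  rw [← star_form, form_sum_left, star_sum]
  simp only [star_mul', star_form]

lemma form_add_left (x x' y : Option (Fin (N + 1)) → ℂ) :
    form ℓ (x + x') y = form ℓ x y + form ℓ x' y := map_add (formLinear ℓ y) x x'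

lemma form_smul_left (a : ℂ) (x y : Option (Fin (N + 1)) → ℂ) :
    form ℓ (a • x) y = a * form ℓ x y := map_smul (formLinear ℓ y) a x

lemma form_zero_left (y : Option (Fin (N + 1)) → ℂ) : form ℓ 0 y = 0 := map_zero (formLinear ℓ y)

lemma form_add_right (x y y' : Option (Fin (N + 1)) → ℂ) :
    form ℓ x (y + y') = form ℓ x y + form ℓ x y' := by
  rw [← star_form, form_add_left, star_add, star_form, star_form]

lemma form_smul_right (a : ℂ) (x y : Option (Fin (N + 1)) → ℂ) :
    form ℓ x (a • y) = star a * form ℓ x y := by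
  rw [← star_form, form_smul_left, star_mul', star_form]

lemma form_self_im (x : Option (Fin (N + 1)) → ℂ) : (form ℓ x x).im = 0 :=
  Complex.conj_eq_iff_im.1 (star_form ℓ x x)

lemma sgn_ne_zero (j : ℕ) : sgn ℓ j ≠ 0 := by
  unfold sgn; split_ifs <;> norm_num

lemma form_single_none (x : Option (Fin (N + 1)) → ℂ) :
    form ℓ x (Pi.single none 1) = 1 / (2 * Complex.I) * x (some (Fin.last N)) := by
  simp [form]

lemma form_single_last (x : Option (Fin (N + 1)) → ℂ) :
    form ℓ x (Pi.single (some (Fin.last N)) 1) = -(1 / (2 * Complex.I) * x none) := by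
  simp [form, (Fin.castSucc_lt_last _).ne]

lemma form_single_castSucc (x : Option (Fin (N + 1)) → ℂ) (j : Fin N) :
    form ℓ x (Pi.single (some j.castSucc) 1) = -(((sgn ℓ j : ℝ) : ℂ) * x (some j.castSucc)) := by
  rw [form, Finset.sum_eq_single j]
  · simp [(Fin.castSucc_lt_last _).ne']
  · intro i _ hi
    simp [Fin.castSucc_inj, hi]
  · simp

lemma half_I_ne_zero : 1 / (2 * Complex.I) ≠ 0 := by simp

/-- Nondegeneracy: pairing with the standard basis reads off every coordinate up to a nonzero
factor. -/
lemma eq_zero_of_form_single_eq_zero (x : Option (Fin (N + 1)) → ℂ)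
    (h : ∀ i, form ℓ x (Pi.single i 1) = 0) : x = 0 := by
  funext i
  rcases i with _ | i
  · have := h (some (Fin.last N))
    rw [form_single_last, neg_eq_zero] at this
    exact (mul_eq_zero.1 this).resolve_left half_I_ne_zero
  · induction i using Fin.lastCases with
    | last =>
      have := h none
      rw [form_single_none] at this
      exact (mul_eq_zero.1 this).resolve_left half_I_ne_zero
    | cast j =>
      have := h (some j.castSucc)
      rw [form_single_castSucc, neg_eq_zero] at this
      exact (mul_eq_zero.1 this).resolve_left (by simpa using sgn_ne_zero ℓ j)

/-- The matrices that preserve the form. -/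
def IsUnitary (U : Matrix (Option (Fin (N + 1))) (Option (Fin (N + 1))) ℂ) : Prop :=
  ∀ x y, form ℓ (U.mulVec x) (U.mulVec y) = form ℓ x y

variable {ℓ}

lemma IsUnitary.isUnit {U : Matrix (Option (Fin (N + 1))) (Option (Fin (N + 1))) ℂ}
    (hU : IsUnitary ℓ U) : IsUnit U := by
  rw [← Matrix.mulVec_injective_iff_isUnit]
  rw [← Matrix.coe_mulVecLin, ← LinearMap.ker_eq_bot, LinearMap.ker_eq_bot']
  intro x hx
  refine eq_zero_of_form_single_eq_zero ℓ x fun i => ?_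
  rw [← hU, ← Matrix.mulVecLin_apply, hx, form_zero_left]

lemma IsUnitary.inv {U : Matrix (Option (Fin (N + 1))) (Option (Fin (N + 1))) ℂ}
    (hU : IsUnitary ℓ U) : IsUnitary ℓ U⁻¹ := by
  intro x y
  have hdet := (Matrix.isUnit_iff_isUnit_det U).1 hU.isUnit
  rw [← hU, Matrix.mulVec_mulVec, Matrix.mulVec_mulVec, Matrix.mul_nonsing_inv U hdet,
    Matrix.one_mulVec, Matrix.one_mulVec]

lemma isUnitary_of_gram {c : Option (Fin (N + 1)) → Option (Fin (N + 1)) → ℂ}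
    (hc : ∀ i i', form ℓ (c i) (c i') = form ℓ (Pi.single i 1 : Option (Fin (N + 1)) → ℂ)
      (Pi.single i' 1)) :
    IsUnitary ℓ (Matrix.of fun i j => c j i) := by
  have key : ∀ x : Option (Fin (N + 1)) → ℂ, (Matrix.of fun i j => c j i).mulVec x
      = ∑ i, x i • c i := by
    intro x
    funext i
    simp [Matrix.mulVec, dotProduct, Finset.sum_apply, mul_comm]
  have key2 : ∀ x : Option (Fin (N + 1)) → ℂ,
      x = ∑ i, x i • (Pi.single i 1 : Option (Fin (N + 1)) → ℂ) := by
    intro x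
    funext i
    simp [Finset.sum_apply, Pi.single_apply]
  intro x y
  rw [key, key]
  conv_rhs => rw [key2 x, key2 y]
  simp only [form_sum_left, form_sum_right, hc]

end form

/-! ### Frames, their orthogonal complements and Witt extension -/

/-- Vectors with the same Gram matrix as the standard basis of `ℂⁿ⁺²`. -/
def IsFrame {n N : ℕ} (ℓ : ℕ) (b : Option (Fin (n + 1)) → Option (Fin (N + 1)) → ℂ) : Prop :=
  ∀ i i', form ℓ (b i) (b i') = form ℓ (Pi.single i 1 : Option (Fin (n + 1)) → ℂ) (Pi.single i' 1)

section frame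

variable {n N ℓ : ℕ}

/-- The form has signature (ℓ + 1, N - ℓ + 1). These ℓ + 1 linear conditions cut out a negative
definite subspace of complementary dimension, which bounds the dimension of nonnegative subspaces.
-/
lemma form_self_of_isotropic_part {y : Option (Fin (N + 1)) → ℂ}
    (hp : y none = Complex.I * y (some (Fin.last N)))
    (hz : ∀ j : Fin N, (j : ℕ) < ℓ → y (some j.castSucc) = 0) :
    (form ℓ y y).re = -(‖y (some (Fin.last N))‖ ^ 2 + ∑ j : Fin N, ‖y (some j.castSucc)‖ ^ 2) := by
  have h1 : form ℓ y y = ((-(‖y (some (Fin.last N))‖ ^ 2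
      + ∑ j : Fin N, ‖y (some j.castSucc)‖ ^ 2) : ℝ) : ℂ) := by
    rw [form, hp]
    push_cast
    rw [neg_add', ← Complex.mul_conj']
    congr 1
    · rw [star_mul']
      simp only [Complex.star_def, Complex.conj_I]
      field_simp
      ring
    · refine Finset.sum_congr rfl fun j _ => ?_
      by_cases hj : (j : ℕ) < ℓ
      · rw [hz j hj]; simp
      · rw [sgn, if_neg hj, Complex.ofReal_one, one_mul]
        exact Complex.mul_conj' _
  rw [h1, Complex.ofReal_re]

/-- The orthogonal complement of a frame of the same signature is definite. -/
lemma IsFrame.form_self_neg (hN : ℓ ≤ N) (hn : ℓ ≤ n)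
    {b : Option (Fin (n + 1)) → Option (Fin (N + 1)) → ℂ} (hb : IsFrame ℓ b)
    {x : Option (Fin (N + 1)) → ℂ} (hx : ∀ i, form ℓ x (b i) = 0) (hx0 : x ≠ 0) :
    (form ℓ x x).re < 0 := by
  by_contra hneg
  push Not at hneg
  have hx' : ∀ i, form ℓ (b i) x = 0 := fun i => by rw [← star_form, hx, star_zero]
  obtain ⟨e, he⟩ : ∃ e : Fin ℓ → Fin n, ∀ j, (e j : ℕ) = j := ⟨Fin.castLE hn, fun _ => rfl⟩
  have hinj : ∀ j j', e j = e j' ↔ j = j' := fun j j' => by rw [Fin.ext_iff, he, he, Fin.ext_iff]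
  -- Here b none + i b(w) has norm 1, as have the b(z_j) with j < ℓ. Together with x this makes ℓ +
  -- 2 orthogonal vectors of nonnegative norm, one too many for the signature.
  let v : Option (Option (Fin ℓ)) → Option (Fin (N + 1)) → ℂ := fun t => t.elim x fun t =>
    t.elim (b none + Complex.I • b (some (Fin.last n))) fun j => b (some (e j).castSucc)
  let Y : (Option (Option (Fin ℓ)) → ℂ) →ₗ[ℂ] (Option (Fin (N + 1)) → ℂ) :=
    Fintype.linearCombination ℂ v
  -- The ℓ + 1 conditions defining the negative definite subspace. A nontrivial combination of the ℓ
  -- + 2 vectors satisfies them all.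
  let Λ : (Option (Fin (N + 1)) → ℂ) →ₗ[ℂ] (Option (Fin ℓ) → ℂ) :=
    LinearMap.pi fun t => t.elim (LinearMap.proj none - Complex.I • LinearMap.proj (some (Fin.last N)))
      fun j => LinearMap.proj (some (Fin.castLE hN j).castSucc)
  obtain ⟨a, ha, ha0⟩ := (Submodule.ne_bot_iff _).1
    (LinearMap.ker_ne_bot_of_finrank_lt (f := Λ ∘ₗ Y) (by simp))
  rw [LinearMap.mem_ker, LinearMap.comp_apply] at ha
  have hY : Y a = ∑ t, a t • v t := Fintype.linearCombination_apply ℂ v a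
  let δ : Option (Option (Fin ℓ)) → ℝ := fun t => t.elim (form ℓ x x).re fun _ => 1
  have horth : ∀ t t', form ℓ (v t) (v t') = if t = t' then ((δ t : ℝ) : ℂ) else 0 := by
    have hxx : form ℓ x x = (((form ℓ x x).re : ℝ) : ℂ) :=
      Complex.ext (by simp) (by simp [form_self_im])
    rintro (_ | _ | j) (_ | _ | j')
    · simpa [v, δ] using hxx
    · simp [v, form_add_right, form_smul_right, hx]
    · simp [v, hx]
    · simp [v, form_add_left, form_smul_left, hx']
    · simp only [v, δ, Option.elim, form_add_left, form_smul_left, form_add_right, form_smul_right,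
        hb none, hb (some _), form_single_none, form_single_last]
      simp
      ring_nf
      simp
    · simp only [v, Option.elim, form_add_left, form_smul_left, hb none, hb (some _),
        form_single_castSucc]
      simp [(Fin.castSucc_lt_last _).ne]
    · simp [v, hx']
    · simp only [v, Option.elim, form_add_right, form_smul_right, hb (some _),
        form_single_none, form_single_last]
      simp [(Fin.castSucc_lt_last _).ne']
    · simp only [v, δ, Option.elim, hb (some _), form_single_castSucc, he, sgn, j'.2, if_true]
      by_cases h : j = j'
      · simp [h]
      · simp [hinj, h, Ne.symm h]
  have hform : (form ℓ (Y a) (Y a)).re = ∑ t, ‖a t‖ ^ 2 * δ t := by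
    have : form ℓ (Y a) (Y a) = ((∑ t, ‖a t‖ ^ 2 * δ t : ℝ) : ℂ) := by
      rw [hY, form_sum_left]
      push_cast
      refine Finset.sum_congr rfl fun t _ => ?_
      rw [form_sum_right, Finset.sum_eq_single t]
      · rw [horth, if_pos rfl, ← Complex.mul_conj']
        simp only [Complex.star_def]
        ring
      · intro t' _ ht
        rw [horth, if_neg ht.symm, mul_zero]
      · simp
    rw [this, Complex.ofReal_re]
  have hδ : ∀ t, 0 ≤ δ t := by
    rintro (_ | t)
    · exact hneg
    · exact zero_le_one
  have hnn : 0 ≤ ∑ t, ‖a t‖ ^ 2 * δ t :=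
    Finset.sum_nonneg fun t _ => mul_nonneg (by positivity) (hδ t)
  have hp : Y a none = Complex.I * Y a (some (Fin.last N)) :=
    sub_eq_zero.1 (congrFun ha none)
  have hz : ∀ j : Fin N, (j : ℕ) < ℓ → Y a (some j.castSucc) = 0 := fun j hj =>
    congrFun ha (some ⟨j, hj⟩)
  have hneg2 := form_self_of_isotropic_part hp hz
  rw [hform] at hneg2
  have h1 : 0 ≤ ∑ j : Fin N, ‖Y a (some j.castSucc)‖ ^ 2 :=
    Finset.sum_nonneg fun _ _ => by positivity
  have h2 : 0 ≤ ‖Y a (some (Fin.last N))‖ ^ 2 := by positivity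
  have hq : Y a (some (Fin.last N)) = 0 := by
    have : ‖Y a (some (Fin.last N))‖ ^ 2 = 0 := by linarith
    simpa using this
  have hj : ∀ j : Fin N, Y a (some j.castSucc) = 0 := by
    intro j
    have := (Finset.sum_eq_zero_iff_of_nonneg (fun _ _ => by positivity)).1
      (show ∑ j : Fin N, ‖Y a (some j.castSucc)‖ ^ 2 = 0 by linarith) j (Finset.mem_univ j)
    simpa using this
  have hYa : Y a = 0 := by
    funext i
    rcases i with _ | i
    · rw [hp, hq]; simp
    · induction i using Fin.lastCases with
      | last => exact hq
      | cast j => exact hj j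
  have hsum : ∑ t, ‖a t‖ ^ 2 * δ t = 0 := by linarith
  have ht : ∀ t, a (some t) = 0 := by
    intro t
    have := (Finset.sum_eq_zero_iff_of_nonneg
      (fun t _ => mul_nonneg (by positivity) (hδ t))).1 hsum (some t) (Finset.mem_univ _)
    simpa [δ] using this
  have ht0 : a none = 0 := by
    rw [hYa, Fintype.sum_option] at hY
    simp only [ht, zero_smul, Finset.sum_const_zero, add_zero] at hY
    exact (smul_eq_zero.1 hY.symm).resolve_right hx0
  refine ha0 (funext fun t => ?_)
  rcases t with _ | t
  · exact ht0
  · exact ht t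

/-- A subspace on which the form is negative definite has an orthonormal basis. -/
lemma exists_orthonormal_of_neg {V : Type*} [AddCommGroup V] [Module ℂ V] [FiniteDimensional ℂ V]
    (ι : V →ₗ[ℂ] Option (Fin (N + 1)) → ℂ) (hneg : ∀ x, x ≠ 0 → (form ℓ (ι x) (ι x)).re < 0) :
    ∃ v : Fin (Module.finrank ℂ V) → V,
      ∀ i i', form ℓ (ι (v i)) (ι (v i')) = if i = i' then -1 else 0 := by
  -- Minus the form is an inner product; its arguments are exchanged because inner products here are
  -- conjugate-linear in the first one.
  let core : InnerProductSpace.Core ℂ V :=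
    { inner := fun x y => -form ℓ (ι y) (ι x)
      conj_inner_symm := fun x y => by
        rw [map_neg]
        exact congrArg Neg.neg (star_form ℓ _ _)
      re_inner_nonneg := fun x => by
        by_cases hx : x = 0
        · simp [hx, form_zero_left]
        · simp only [map_neg]
          exact (neg_pos.2 (hneg x hx)).le
      add_left := fun x y z => by
        simp only [map_add, form_add_right, neg_add]
      smul_left := fun x y r => by
        simp only [map_smul, form_smul_right, mul_neg]
        rfl
      definite := fun x hx => by
        by_contra hx0
        have := hneg x hx0
        rw [neg_eq_zero.1 hx] at this
        simp at this }
  let _ : NormedAddCommGroup V := core.toNormedAddCommGroup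
  let _ : InnerProductSpace ℂ V := InnerProductSpace.ofCore core.toCore
  have hinner : ∀ x y : V, inner ℂ x y = -form ℓ (ι y) (ι x) := fun _ _ => rfl
  have ho := (stdOrthonormalBasis ℂ V).orthonormal
  rw [orthonormal_iff_ite] at ho
  refine ⟨fun i => stdOrthonormalBasis ℂ V i, fun i i' => ?_⟩
  have := ho i' i
  rw [hinner, neg_eq_iff_eq_neg] at this
  rw [this]
  by_cases h : i = i'
  · simp [h]
  · simp [h, Ne.symm h]

lemma IsFrame.exists_orthonormal_complement {k : ℕ} (hn : ℓ ≤ n)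
    {b : Option (Fin (n + 1)) → Option (Fin (n + k + 1)) → ℂ} (hb : IsFrame ℓ b) :
    ∃ v : Fin k → Option (Fin (n + k + 1)) → ℂ, (∀ i i', form ℓ (v i) (b i') = 0) ∧
      ∀ i i', form ℓ (v i) (v i') = if i = i' then -1 else 0 := by
  let Λ : (Option (Fin (n + k + 1)) → ℂ) →ₗ[ℂ] (Option (Fin (n + 1)) → ℂ) :=
    LinearMap.pi fun i => formLinear ℓ (b i)
  have hW : ∀ x : LinearMap.ker Λ, ∀ i, form ℓ (x : Option (Fin (n + k + 1)) → ℂ) (b i) = 0 :=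
    fun x i => congrFun (LinearMap.mem_ker.1 x.2) i
  have hrank : k ≤ Module.finrank ℂ (LinearMap.ker Λ) := by
    have h1 := LinearMap.finrank_range_add_finrank_ker Λ
    have h2 := Submodule.finrank_le (LinearMap.range Λ)
    simp only [Module.finrank_fintype_fun_eq_card, Fintype.card_option, Fintype.card_fin] at h1 h2
    omega
  obtain ⟨v, hv⟩ := exists_orthonormal_of_neg (ℓ := ℓ) (LinearMap.ker Λ).subtype fun x hx =>
    hb.form_self_neg (by omega) hn (hW x) (by simpa using hx)
  refine ⟨fun i => v (Fin.castLE hrank i), fun i i' => hW _ _, fun i i' => ?_⟩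
  refine (hv _ _).trans ?_
  simp only [(Fin.castLE_injective hrank).eq_iff]

/-- The inclusion of the homogeneous coordinates of `ℂⁿ × ℂ` in those of `ℂⁿ⁺ᵏ × ℂ`. -/
def coordIncl (n k : ℕ) : Option (Fin (n + 1)) → Option (Fin (n + k + 1)) :=
  Option.map (Fin.lastCases (Fin.last _) fun j => (Fin.castAdd k j).castSucc)

@[simp] lemma coordIncl_none (n k : ℕ) : coordIncl n k none = none := rfl

@[simp] lemma coordIncl_last (n k : ℕ) :
    coordIncl n k (some (Fin.last n)) = some (Fin.last (n + k)) := by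
  simp [coordIncl]

@[simp] lemma coordIncl_castSucc (n k : ℕ) (j : Fin n) :
    coordIncl n k (some j.castSucc) = some (Fin.castAdd k j).castSucc := by
  simp [coordIncl]

lemma mem_range_coordIncl_or (n k : ℕ) (i : Option (Fin (n + k + 1))) :
    (∃ i₀, i = coordIncl n k i₀) ∨ ∃ j : Fin k, i = some (Fin.natAdd n j).castSucc := by
  rcases i with _ | i
  · exact Or.inl ⟨none, rfl⟩
  · induction i using Fin.lastCases with
    | last => exact Or.inl ⟨some (Fin.last n), by simp⟩
    | cast i =>
      induction i using Fin.addCases with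
      | left j => exact Or.inl ⟨some j.castSucc, by simp⟩
      | right j => exact Or.inr ⟨j, rfl⟩

lemma coordIncl_injective (n k : ℕ) : Function.Injective (coordIncl n k) := by
  refine Option.map_injective fun i i' h => ?_
  induction i using Fin.lastCases with
  | last =>
    induction i' using Fin.lastCases with
    | last => rfl
    | cast j => simp [Fin.ext_iff] at h; omega
  | cast j =>
    induction i' using Fin.lastCases with
    | last => simp [Fin.ext_iff] at h; omega
    | cast j' => simpa [Fin.ext_iff] using h

lemma coordIncl_ne_natAdd {n k : ℕ} (i : Option (Fin (n + 1))) (j : Fin k) :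
    coordIncl n k i ≠ some (Fin.natAdd n j).castSucc := by
  rcases i with _ | i
  · simp
  · induction i using Fin.lastCases with
    | last => simp [Fin.ext_iff]; omega
    | cast i => simp [Fin.ext_iff]; omega

lemma form_single_coordIncl (n k : ℕ) (x : Option (Fin (n + k + 1)) → ℂ)
    (i : Option (Fin (n + 1))) :
    form ℓ x (Pi.single (coordIncl n k i) 1)
      = form ℓ (fun i => x (coordIncl n k i)) (Pi.single i 1) := by
  rcases i with _ | i
  · simp only [coordIncl_none, form_single_none, coordIncl_last]
  · induction i using Fin.lastCases with
    | last => simp only [coordIncl_last, form_single_last, coordIncl_none]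
    | cast j => simp only [coordIncl_castSucc, form_single_castSucc, Fin.val_castAdd]

/-- A frame of the same signature is carried to standard basis vectors by a unitary matrix. -/
lemma IsFrame.exists_isUnitary {k : ℕ} (hn : ℓ ≤ n)
    {b : Option (Fin (n + 1)) → Option (Fin (n + k + 1)) → ℂ} (hb : IsFrame ℓ b) :
    ∃ U : Matrix (Option (Fin (n + k + 1))) (Option (Fin (n + k + 1))) ℂ, IsUnitary ℓ U ∧
      ∀ i, U.mulVec (b i) = Pi.single (coordIncl n k i) 1 := by
  obtain ⟨v, hvb, hv⟩ := hb.exists_orthonormal_complement hn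
  have hbv : ∀ i i', form ℓ (b i) (v i') = 0 := fun i i' => by
    rw [← star_form, hvb, star_zero]
  obtain ⟨c, hcb, hcv⟩ : ∃ c : Option (Fin (n + k + 1)) → Option (Fin (n + k + 1)) → ℂ,
      (∀ i, c (coordIncl n k i) = b i) ∧
        ∀ j : Fin k, c (some (Fin.natAdd n j).castSucc) = v j := by
    refine ⟨fun i => i.elim (b none) (Fin.lastCases (b (some (Fin.last n)))
      (Fin.addCases (fun j => b (some j.castSucc)) v)), fun i => ?_, fun j => ?_⟩
    · rcases i with _ | i
      · rfl
      · induction i using Fin.lastCases with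
        | last => rw [coordIncl_last]; exact Fin.lastCases_last (motive := fun _ => _)
        | cast j =>
          rw [coordIncl_castSucc]
          exact (Fin.lastCases_castSucc (motive := fun _ => _) _).trans
            (Fin.addCases_left (motive := fun _ => _) _)
    · exact (Fin.lastCases_castSucc (motive := fun _ => _) _).trans
        (Fin.addCases_right (motive := fun _ => _) _)
  have hc : ∀ i i', form ℓ (c i) (c i') =
      form ℓ (Pi.single i 1 : Option (Fin (n + k + 1)) → ℂ) (Pi.single i' 1) := by
    have hadd : ∀ (x : Option (Fin (n + k + 1)) → ℂ) (j : Fin k),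
        form ℓ x (Pi.single (some (Fin.natAdd n j).castSucc) 1)
          = -x (some (Fin.natAdd n j).castSucc) := by
      intro x j
      rw [form_single_castSucc, sgn, if_neg (by simp; omega)]
      simp
    intro i i'
    rcases mem_range_coordIncl_or n k i with ⟨i, rfl⟩ | ⟨j, rfl⟩ <;>
      rcases mem_range_coordIncl_or n k i' with ⟨i', rfl⟩ | ⟨j', rfl⟩
    · rw [hcb, hcb, hb, form_single_coordIncl]
      congr 1
      funext i₀
      simp only [Pi.single_apply, (coordIncl_injective n k).eq_iff]
    · rw [hcb, hcv, hbv, hadd, Pi.single_apply, if_neg (coordIncl_ne_natAdd _ _).symm, neg_zero]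
    · rw [hcb, hcv, hvb, form_single_coordIncl]
      symm
      convert form_zero_left ℓ _
      exact Pi.single_eq_of_ne (coordIncl_ne_natAdd _ _) _
    · rw [hcv, hcv, hv, hadd, Pi.single_apply]
      by_cases h : j = j'
      · simp [h]
      · simp [h, Fin.ext_iff, Fin.val_ne_of_ne (Ne.symm h)]
  have hU := isUnitary_of_gram hc
  -- The matrix with columns c carries standard vectors to the frame, so its inverse is the one
  -- required.
  refine ⟨_, hU.inv, fun i => ?_⟩
  have hdet := (Matrix.isUnit_iff_isUnit_det _).1 hU.isUnit
  have : b i = (Matrix.of fun i j => c j i).mulVec (Pi.single (coordIncl n k i) 1) := by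
    rw [← hcb, Matrix.mulVec_single_one]
    rfl
  rw [this, Matrix.mulVec_mulVec, Matrix.nonsing_inv_mul _ hdet, Matrix.one_mulVec]

end frame

/-! ### Values of convergent power series -/

section evaluation

variable {M : ℕ}

/-- The series `P` converges at `Z`, with sum `p`. -/
def HasValue (P : MvPowerSeries (Fin M) ℂ) (Z : Fin M → ℂ) (p : ℂ) : Prop :=
  HasSum (fun d : Fin M →₀ ℕ => MvPowerSeries.coeff d P * ∏ m, Z m ^ d m) p

variable {P Q : MvPowerSeries (Fin M) ℂ} {Z : Fin M → ℂ} {p q : ℂ}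

lemma HasValue.add (hP : HasValue P Z p) (hQ : HasValue Q Z q) : HasValue (P + Q) Z (p + q) := by
  simpa only [HasValue, map_add, add_mul] using HasSum.add hP hQ

lemma HasValue.sum {ι : Type*} (s : Finset ι) {P : ι → MvPowerSeries (Fin M) ℂ} {p : ι → ℂ}
    (h : ∀ i ∈ s, HasValue (P i) Z (p i)) : HasValue (∑ i ∈ s, P i) Z (∑ i ∈ s, p i) := by
  simpa only [HasValue, map_sum, Finset.sum_mul] using hasSum_sum h

lemma hasSum_mul_antidiagonal {A : Type*} [AddCommMonoid A] [Finset.HasAntidiagonal A]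
    {f g : A → ℂ} {p q : ℂ} (hf : HasSum f p) (hg : HasSum g q) :
    HasSum (fun d => ∑ x ∈ Finset.HasAntidiagonal.antidiagonal d, f x.1 * g x.2) (p * q) := by
  have hs := summable_mul_of_summable_norm hf.summable.norm hg.summable.norm
  have h1 := hf.summable.tsum_mul_tsum_eq_tsum_sum_antidiagonal hg.summable hs
  rw [← hf.tsum_eq, ← hg.tsum_eq, h1]
  exact (summable_sum_mul_antidiagonal_of_summable_mul hs).hasSum

lemma HasValue.mul (hP : HasValue P Z p) (hQ : HasValue Q Z q) : HasValue (P * Q) Z (p * q) := by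
  have h := hasSum_mul_antidiagonal hP hQ
  refine (congrArg (HasSum · (p * q)) (funext fun d => ?_)).mp h
  symm
  rw [MvPowerSeries.coeff_mul, Finset.sum_mul]
  refine Finset.sum_congr rfl fun x hx => ?_
  rw [← Finset.HasAntidiagonal.mem_antidiagonal.1 hx]
  simp only [Finsupp.add_apply, pow_add, Finset.prod_mul_distrib]
  ring

lemma hasValue_C (a : ℂ) (Z : Fin M → ℂ) : HasValue (MvPowerSeries.C a) Z a := by
  have h := hasSum_single (f := fun d : Fin M →₀ ℕ =>
    MvPowerSeries.coeff d (MvPowerSeries.C a) * ∏ m, Z m ^ d m) 0 (by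
      intro d hd
      rw [MvPowerSeries.coeff_C, if_neg hd, zero_mul])
  simpa [HasValue] using h

lemma hasValue_X (i : Fin M) (Z : Fin M → ℂ) : HasValue (MvPowerSeries.X i) Z (Z i) := by
  have h := hasSum_single (f := fun d : Fin M →₀ ℕ =>
    MvPowerSeries.coeff d (MvPowerSeries.X i : MvPowerSeries (Fin M) ℂ) * ∏ m, Z m ^ d m)
    (Finsupp.single i 1) (by
      intro d hd
      rw [MvPowerSeries.coeff_X, if_neg hd, zero_mul])
  rw [MvPowerSeries.coeff_X, if_pos rfl, one_mul, Finset.prod_eq_single i] at h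
  · simpa [HasValue] using h
  · intro b _ hb
    rw [Finsupp.single_eq_of_ne hb, pow_zero]
  · simp

lemma summable_prod_pow {r : ℝ} (h0 : 0 ≤ r) (h1 : r < 1) (M : ℕ) :
    Summable fun d : Fin M → ℕ => ∏ m, r ^ d m := by
  induction M with
  | zero => exact Summable.of_finite
  | succ M ih =>
    rw [← (Fin.consEquiv fun _ => ℕ).summable_iff]
    convert Summable.mul_of_nonneg (summable_geometric_of_lt_one h0 h1) ih
      (fun _ => by positivity) (fun _ => Finset.prod_nonneg fun _ _ => by positivity) using 2 with x
    simp [Fin.prod_univ_succ, Fin.consEquiv]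

/-- The affine function `a + ∑ u_m Z_m`, as a power series. -/
noncomputable def affineSeries (a : ℂ) (u : Fin M → ℂ) : MvPowerSeries (Fin M) ℂ :=
  MvPowerSeries.C a + ∑ m, MvPowerSeries.C (u m) * MvPowerSeries.X m

lemma hasValue_affineSeries (a : ℂ) (u : Fin M → ℂ) (Z : Fin M → ℂ) :
    HasValue (affineSeries a u) Z (a + ∑ m, u m * Z m) :=
  (hasValue_C a Z).add (HasValue.sum _ fun m _ => (hasValue_C (u m) Z).mul (hasValue_X m Z))

lemma constantCoeff_affineSeries (a : ℂ) (u : Fin M → ℂ) :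
    MvPowerSeries.constantCoeff (affineSeries a u) = a := by
  simp [affineSeries]

lemma coeff_mul_X' (P : MvPowerSeries (Fin M) ℂ) (m : Fin M) (d : Fin M →₀ ℕ) :
    MvPowerSeries.coeff d (P * MvPowerSeries.X m) =
      if Finsupp.single m 1 ≤ d then MvPowerSeries.coeff (d - Finsupp.single m 1) P else 0 := by
  rw [MvPowerSeries.X, MvPowerSeries.coeff_mul_monomial]
  simp only [mul_one]

/-- Comparing coefficients in E · (a + ∑ u_m Z_m) = 1 expresses each coefficient of E through those
of one degree less, so the bound is geometric. -/
lemma norm_coeff_inv_affineSeries_le {a : ℂ} (ha : a ≠ 0) (u : Fin M → ℂ) (d : Fin M →₀ ℕ) :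
    ‖MvPowerSeries.coeff d (affineSeries a u)⁻¹‖ ≤
      ‖a‖⁻¹ * ((∑ m, ‖u m‖) / ‖a‖) ^ d.degree := by
  have ha' : 0 < ‖a‖ := norm_pos_iff.2 ha
  have hmul : (affineSeries a u)⁻¹ * affineSeries a u = 1 :=
    MvPowerSeries.inv_mul_cancel _ (by rwa [constantCoeff_affineSeries])
  have hS : 0 ≤ ∑ m, ‖u m‖ := Finset.sum_nonneg fun _ _ => norm_nonneg _
  set E := (affineSeries a u)⁻¹
  have hrec : ∀ d : Fin M →₀ ℕ, MvPowerSeries.coeff d E * a + ∑ m, u m *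
      (if Finsupp.single m 1 ≤ d then MvPowerSeries.coeff (d - Finsupp.single m 1) E else 0)
      = if d = 0 then 1 else 0 := by
    intro d
    rw [← MvPowerSeries.coeff_one, ← hmul, affineSeries, mul_add, map_add, Finset.mul_sum, map_sum,
      MvPowerSeries.coeff_mul_C]
    congr 1
    refine Finset.sum_congr rfl fun m _ => ?_
    rw [mul_left_comm, MvPowerSeries.coeff_C_mul, coeff_mul_X']
  obtain ⟨l, hl⟩ : ∃ l, d.degree = l := ⟨_, rfl⟩
  induction l generalizing d with
  | zero =>
    rw [Finsupp.degree_eq_zero_iff] at hl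
    subst hl
    have h1 := hrec 0
    rw [if_pos rfl, Finset.sum_eq_zero, add_zero] at h1
    · rw [map_zero, pow_zero, mul_one, eq_inv_of_mul_eq_one_left h1, norm_inv]
    · intro m _
      rw [if_neg, mul_zero]
      simp
  | succ l ih =>
    have hd : d ≠ 0 := by
      rintro rfl
      simp at hl
    have h1 := hrec d
    rw [if_neg hd, add_eq_zero_iff_eq_neg] at h1
    rw [hl, pow_succ, ← mul_assoc, ← mul_div_assoc, le_div_iff₀ ha', ← norm_mul, h1, norm_neg,
      Finset.mul_sum]
    refine (norm_sum_le _ _).trans (Finset.sum_le_sum fun m _ => ?_)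
    rw [norm_mul, mul_comm]
    refine mul_le_mul_of_nonneg_right ?_ (norm_nonneg _)
    split_ifs with hle
    · have hdeg : (d - Finsupp.single m 1).degree = l := by
        obtain ⟨e, rfl⟩ := exists_add_of_le hle
        rw [map_add, Finsupp.degree_single] at hl
        rw [add_tsub_cancel_left]
        omega
      have := ih _ hdeg
      rwa [hdeg] at this
    · rw [norm_zero]
      positivity

lemma hasValue_inv_affineSeries {a : ℂ} (ha : a ≠ 0) (u : Fin M → ℂ) :
    ∀ᶠ Z in 𝓝 (0 : Fin M → ℂ), HasValue (affineSeries a u)⁻¹ Z (a + ∑ m, u m * Z m)⁻¹ := by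
  have hS : 0 ≤ (∑ m, ‖u m‖) / ‖a‖ :=
    div_nonneg (Finset.sum_nonneg fun _ _ => norm_nonneg _) (norm_nonneg _)
  have hsmall : ∀ᶠ Z in 𝓝 (0 : Fin M → ℂ), (∑ m, ‖u m‖) / ‖a‖ * ‖Z‖ < 1 := by
    have : ContinuousAt (fun Z : Fin M → ℂ => (∑ m, ‖u m‖) / ‖a‖ * ‖Z‖) 0 := by fun_prop
    exact this.eventually_lt continuousAt_const (by simp)
  filter_upwards [hsmall] with Z hZ
  have hmul : (affineSeries a u)⁻¹ * affineSeries a u = 1 :=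
    MvPowerSeries.inv_mul_cancel _ (by rwa [constantCoeff_affineSeries])
  have hsum : Summable fun d : Fin M →₀ ℕ =>
      MvPowerSeries.coeff d (affineSeries a u)⁻¹ * ∏ m, Z m ^ d m := by
    have h1 := (summable_prod_pow (r := (∑ m, ‖u m‖) / ‖a‖ * ‖Z‖) (by positivity) hZ M).mul_left
      ‖a‖⁻¹
    rw [← Finsupp.equivFunOnFinite.summable_iff] at h1
    refine Summable.of_norm_bounded h1 fun d => ?_
    rw [norm_mul, norm_prod]
    refine (mul_le_mul_of_nonneg_right (norm_coeff_inv_affineSeries_le ha u d)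
      (Finset.prod_nonneg fun _ _ => norm_nonneg _)).trans ?_
    rw [mul_assoc]
    refine mul_le_mul_of_nonneg_left ?_ (by positivity)
    simp only [Finsupp.equivFunOnFinite_apply, mul_pow,
      Finset.prod_mul_distrib, norm_pow]
    rw [Finset.prod_pow_eq_pow_sum, Finsupp.degree_eq_sum]
    refine mul_le_mul_of_nonneg_left ?_ (by positivity)
    refine Finset.prod_le_prod (fun _ _ => by positivity) fun m _ => ?_
    exact pow_le_pow_left₀ (norm_nonneg _) (norm_le_pi_norm Z m) _
  have hE : HasValue (affineSeries a u)⁻¹ Z _ := hsum.hasSum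
  have h2 := hE.mul (hasValue_affineSeries a u Z)
  rw [hmul, ← map_one MvPowerSeries.C] at h2
  rwa [← eq_inv_of_mul_eq_one_left (h2.unique (hasValue_C 1 Z))]

end evaluation

/-! ### Projective transformations as local automorphisms -/

section projective

variable {N ℓ : ℕ}

/-- The homogeneous coordinates of a point. -/
def homog (Z : Fin (N + 1) → ℂ) : Option (Fin (N + 1)) → ℂ := fun i => i.elim 1 Z

/-- The projective transformation with the matrix `U`, in affine coordinates. -/
noncomputable def projMap (U : Matrix (Option (Fin (N + 1))) (Option (Fin (N + 1))) ℂ)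
    (Z : Fin (N + 1) → ℂ) : Fin (N + 1) → ℂ :=
  fun i => U.mulVec (homog Z) (some i) / U.mulVec (homog Z) none

lemma mulVec_homog (U : Matrix (Option (Fin (N + 1))) (Option (Fin (N + 1))) ℂ)
    (Z : Fin (N + 1) → ℂ) (i : Option (Fin (N + 1))) :
    U.mulVec (homog Z) i = U i none + ∑ m, U i (some m) * Z m := by
  simp [Matrix.mulVec, dotProduct, Fintype.sum_option, homog]

lemma mem_quadric_iff (Z : Fin (N + 1) → ℂ) :
    Z ∈ quadric N ℓ ↔ form ℓ (homog Z) (homog Z) = 0 := by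
  have : form ℓ (homog Z) (homog Z) =
      (((Z (Fin.last N)).im - ∑ j : Fin N, sgn ℓ j * ‖Z j.castSucc‖ ^ 2 : ℝ) : ℂ) := by
    simp only [form, homog, Option.elim, star_one, mul_one, one_mul, Complex.star_def,
      Complex.mul_conj']
    push_cast
    congr 1
    rw [Complex.sub_conj]
    field_simp
    push_cast
    ring
  rw [this, Complex.ofReal_eq_zero, sub_eq_zero, quadric, Set.mem_ofPred_eq]

lemma homog_projMap (U : Matrix (Option (Fin (N + 1))) (Option (Fin (N + 1))) ℂ)
    {Z : Fin (N + 1) → ℂ} (hZ : U.mulVec (homog Z) none ≠ 0) :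
    U.mulVec (homog Z) = U.mulVec (homog Z) none • homog (projMap U Z) := by
  funext i
  rcases i with _ | i
  · simp [homog]
  · simp only [Pi.smul_apply, homog, Option.elim, projMap, smul_eq_mul]
    rw [mul_div_cancel₀]
    exact hZ

lemma projMap_one (Z : Fin (N + 1) → ℂ) : projMap 1 Z = Z := by
  funext i
  simp [projMap, homog]

lemma projMap_projMap (V U : Matrix (Option (Fin (N + 1))) (Option (Fin (N + 1))) ℂ)
    {Z : Fin (N + 1) → ℂ} (hZ : U.mulVec (homog Z) none ≠ 0) :
    projMap V (projMap U Z) = projMap (V * U) Z := by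
  funext i
  rw [projMap, projMap, ← Matrix.mulVec_mulVec, homog_projMap U hZ, Matrix.mulVec_smul,
    Pi.smul_apply, Pi.smul_apply, smul_eq_mul, smul_eq_mul, mul_div_mul_left _ _ hZ]

variable {U : Matrix (Option (Fin (N + 1))) (Option (Fin (N + 1))) ℂ}

lemma eventually_mulVec_homog_ne_zero (h0 : U none none ≠ 0) :
    ∀ᶠ Z in 𝓝 (0 : Fin (N + 1) → ℂ), U.mulVec (homog Z) none ≠ 0 := by
  simp only [mulVec_homog]
  have : ContinuousAt (fun Z : Fin (N + 1) → ℂ => U none none + ∑ m, U none (some m) * Z m) 0 :=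
    (by continuity : Continuous _).continuousAt
  exact this.eventually_ne (by simpa using h0)

lemma analyticAt_projMap (h0 : U none none ≠ 0) : AnalyticAt ℂ (projMap U) 0 := by
  have haff : ∀ i, AnalyticAt ℂ (fun Z : Fin (N + 1) → ℂ => U.mulVec (homog Z) i) 0 := by
    intro i
    simp only [mulVec_homog]
    refine analyticAt_const.add (Finset.analyticAt_fun_sum _ fun m _ => analyticAt_const.mul ?_)
    exact (ContinuousLinearMap.proj (R := ℂ) (φ := fun _ : Fin (N + 1) => ℂ) m).analyticAt 0
  refine AnalyticAt.pi fun i => (haff _).fun_div (haff none) ?_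
  simpa [mulVec_homog] using h0

lemma projMap_zero (hU : ∀ i, U (some i) none = 0) : projMap U 0 = 0 := by
  funext i
  simp [projMap, mulVec_homog, hU]

lemma fderiv_projMap_comp {V : Matrix (Option (Fin (N + 1))) (Option (Fin (N + 1))) ℂ}
    (hVU : V * U = 1) (hU : ∀ i, U (some i) none = 0) (h0 : U none none ≠ 0)
    (h0' : V none none ≠ 0) :
    (fderiv ℂ (projMap V) 0).comp (fderiv ℂ (projMap U) 0)
      = ContinuousLinearMap.id ℂ (Fin (N + 1) → ℂ) := by
  have hz := projMap_zero hU
  have h1 : projMap V ∘ projMap U =ᶠ[𝓝 0] id := by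
    filter_upwards [eventually_mulVec_homog_ne_zero h0] with Z hZ
    rw [Function.comp_apply, projMap_projMap V U hZ, hVU, projMap_one, id]
  have h2 := h1.fderiv_eq (𝕜 := ℂ)
  rw [fderiv_id, fderiv_comp _ (by rw [hz]; exact (analyticAt_projMap h0').differentiableAt)
    (analyticAt_projMap h0).differentiableAt, hz] at h2
  exact h2

/-- A unitary matrix that fixes the line of the base point induces an automorphism. -/
lemma IsUnitary.isAut (hU : IsUnitary ℓ U) (hs : ∀ i, U (some i) none = 0) :
    U none none ≠ 0 ∧ IsAut N ℓ (projMap U) := by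
  have hdet := (Matrix.isUnit_iff_isUnit_det U).1 hU.isUnit
  have hVU := Matrix.nonsing_inv_mul U hdet
  have hUV := Matrix.mul_nonsing_inv U hdet
  -- Since U maps the base vector to a multiple of itself, so does its inverse, and the multiple is
  -- nonzero.
  have hcol : ∀ i, U⁻¹ i none * U none none = if i = none then 1 else 0 := by
    intro i
    have := congrFun (congrFun hVU i) none
    rw [Matrix.mul_apply, Fintype.sum_option] at this
    simpa [hs, Matrix.one_apply] using this
  have h0 : U none none ≠ 0 := by
    intro h
    have := hcol none
    simp [h] at this
  have hs' : ∀ i, U⁻¹ (some i) none = 0 := by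
    intro i
    have := hcol (some i)
    simpa [h0] using this
  have h0' : U⁻¹ none none ≠ 0 := by
    intro h
    have := hcol none
    simp [h] at this
  refine ⟨h0, projMap_zero hs, analyticAt_projMap h0, ?_, ?_⟩
  · have e1 := fderiv_projMap_comp hVU hs h0 h0'
    have e2 := fderiv_projMap_comp hUV hs' h0' h0
    exact Function.bijective_iff_has_inverse.2 ⟨fderiv ℂ (projMap U⁻¹) 0,
      fun x => DFunLike.congr_fun e1 x, fun x => DFunLike.congr_fun e2 x⟩
  · filter_upwards [eventually_mulVec_homog_ne_zero h0] with Z hZ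
    rw [mem_quadric_iff, mem_quadric_iff, ← hU, homog_projMap U hZ, form_smul_left,
      form_smul_right]
    simp [hZ]

/-- The Taylor series of a projective transformation. -/
noncomputable def projSeries (U : Matrix (Option (Fin (N + 1))) (Option (Fin (N + 1))) ℂ)
    (i : Fin (N + 1)) : Series N :=
  affineSeries (U (some i) none) (fun m => U (some i) (some m))
    * (affineSeries (U none none) fun m => U none (some m))⁻¹

lemma isTaylorSeries_projSeries (h0 : U none none ≠ 0) :
    IsTaylorSeries (projMap U) (projSeries U) := by
  filter_upwards [hasValue_inv_affineSeries h0 fun m => U none (some m)] with Z hZ i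
  rw [projMap, mulVec_homog, mulVec_homog, div_eq_mul_inv]
  exact (hasValue_affineSeries _ _ Z).mul hZ

lemma subst_affineSeries {n : ℕ} {H : Fin (N + 1) → Series n}
    (hH : ∀ i, MvPowerSeries.constantCoeff (H i) = 0) (a : ℂ) (u : Fin (N + 1) → ℂ) :
    MvPowerSeries.subst H (affineSeries a u)
      = MvPowerSeries.C a + ∑ m, MvPowerSeries.C (u m) * H m := by
  have hs := MvPowerSeries.hasSubst_of_constantCoeff_zero hH
  rw [affineSeries, ← MvPowerSeries.coe_substAlgHom hs]
  simp only [map_add, map_sum, map_mul, MvPowerSeries.substAlgHom_X]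
  simp

/-- Composition with a projective transformation, in homogeneous coordinates. -/
lemma comp_projSeries_eq {n : ℕ} {H L : Fin (N + 1) → Series n}
    (hH : ∀ i, MvPowerSeries.constantCoeff (H i) = 0) (h0 : U none none ≠ 0) (lam : Series n)
    (hl : MvPowerSeries.C (U none none) + ∑ m, MvPowerSeries.C (U none (some m)) * H m = lam)
    (hL : ∀ i, MvPowerSeries.C (U (some i) none)
      + ∑ m, MvPowerSeries.C (U (some i) (some m)) * H m = lam * L i) :
    comp (projSeries U) H = L := by
  have hs := MvPowerSeries.hasSubst_of_constantCoeff_zero hH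
  funext i
  have h1 : projSeries U i * affineSeries (U none none) (fun m => U none (some m))
      = affineSeries (U (some i) none) (fun m => U (some i) (some m)) := by
    rw [projSeries, mul_assoc, MvPowerSeries.inv_mul_cancel, mul_one]
    rwa [constantCoeff_affineSeries]
  have h2 := congrArg (MvPowerSeries.subst H) h1
  rw [MvPowerSeries.subst_mul hs, subst_affineSeries hH, subst_affineSeries hH, hl, hL,
    mul_comm lam] at h2
  refine mul_right_cancel₀ ?_ h2
  rintro rfl
  have := congrArg MvPowerSeries.constantCoeff hl
  simp [hH, h0] at this

end projective

/-! ### Coefficients of series in (Z, Z̄) -/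

section mixed

variable {n : ℕ}

lemma coeff_hol (P : Series n) (α β : Fin (n + 1) →₀ ℕ) :
    MvPowerSeries.coeff (α.sumElim β) (hol P) = if β = 0 then MvPowerSeries.coeff α P else 0 := by
  split_ifs with h
  · subst h
    have := MvPowerSeries.coeff_embDomain_rename (Function.Embedding.inl
      (α := Fin (n + 1)) (β := Fin (n + 1))) P α
    rwa [Finsupp.embDomain_inl] at this
  · refine MvPowerSeries.coeff_rename_eq_zero _ _ ?_
    rintro ⟨γ, hγ⟩
    refine h (Finsupp.ext fun i => ?_)
    have := DFunLike.congr_fun hγ (Sum.inr i)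
    rw [Finsupp.mapDomain_of_notMem_range _ _ (by simp)] at this
    exact this.symm

lemma coeff_conjHol (P : Series n) (α β : Fin (n + 1) →₀ ℕ) :
    MvPowerSeries.coeff (α.sumElim β) (conjHol P)
      = if α = 0 then star (MvPowerSeries.coeff β P) else 0 := by
  split_ifs with h
  · subst h
    have := MvPowerSeries.coeff_embDomain_rename (Function.Embedding.inr
      (α := Fin (n + 1)) (β := Fin (n + 1))) (MvPowerSeries.map (starRingEnd ℂ) P) β
    rw [Finsupp.embDomain_inr, MvPowerSeries.coeff_map] at this
    exact this
  · refine MvPowerSeries.coeff_rename_eq_zero _ _ ?_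
    rintro ⟨γ, hγ⟩
    refine h (Finsupp.ext fun i => ?_)
    have := DFunLike.congr_fun hγ (Sum.inl i)
    rw [Finsupp.mapDomain_of_notMem_range _ _ (by simp)] at this
    exact this.symm

/-- The two factors involve disjoint sets of variables, so a single splitting of the exponent
contributes. -/
lemma coeff_hol_mul_conjHol (P Q : Series n) (α β : Fin (n + 1) →₀ ℕ) :
    MvPowerSeries.coeff (α.sumElim β) (hol P * conjHol Q)
      = MvPowerSeries.coeff α P * star (MvPowerSeries.coeff β Q) := by
  classical
  rw [MvPowerSeries.coeff_mul, Finset.sum_eq_single (α.sumElim 0, Finsupp.sumElim 0 β)]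
  · simp only [coeff_hol, coeff_conjHol, if_true]
  · rintro ⟨x, y⟩ hxy hne
    rw [Finset.HasAntidiagonal.mem_antidiagonal] at hxy
    obtain ⟨⟨x₁, x₂⟩, rfl⟩ := Finsupp.sumFinsuppEquivProdFinsupp.symm.surjective x
    obtain ⟨⟨y₁, y₂⟩, rfl⟩ := Finsupp.sumFinsuppEquivProdFinsupp.symm.surjective y
    change MvPowerSeries.coeff (x₁.sumElim x₂) _ * MvPowerSeries.coeff (y₁.sumElim y₂) _ = 0
    change x₁.sumElim x₂ + y₁.sumElim y₂ = _ at hxy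
    rw [coeff_hol, coeff_conjHol]
    split_ifs with h1 h2
    · subst h1 h2
      exfalso
      rw [← Finsupp.sumElim_add, add_zero, zero_add] at hxy
      have h1 : x₁ = α := Finsupp.ext fun i => DFunLike.congr_fun hxy (Sum.inl i)
      have h2 : y₂ = β := Finsupp.ext fun i => DFunLike.congr_fun hxy (Sum.inr i)
      subst h1 h2
      exact hne rfl
    all_goals simp
  · intro h
    refine absurd ?_ h
    rw [Finset.HasAntidiagonal.mem_antidiagonal, ← Finsupp.sumElim_add, add_zero, zero_add]

lemma hol_one : hol (1 : Series n) = 1 := map_one _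

lemma conjHol_one : conjHol (1 : Series n) = 1 := by
  rw [conjHol, map_one, map_one]

lemma hol_mul (P Q : Series n) : hol (P * Q) = hol P * hol Q := map_mul _ _ _

lemma conjHol_mul (P Q : Series n) : conjHol (P * Q) = conjHol P * conjHol Q := by
  simp only [conjHol, map_mul]

lemma hol_X (i : Fin (n + 1)) : hol (MvPowerSeries.X i : Series n) = MvPowerSeries.X (Sum.inl i) :=
  MvPowerSeries.rename_X _ _

lemma conjHol_X (i : Fin (n + 1)) :
    conjHol (MvPowerSeries.X i : Series n) = MvPowerSeries.X (Sum.inr i) := by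
  rw [conjHol, MvPowerSeries.map_X, MvPowerSeries.rename_X]

/-- The coefficients of a series in `(Z, Z̄)`. -/
noncomputable def mixedCoeff (a : MixedSeries n) (α β : Fin (n + 1) →₀ ℕ) : ℂ :=
  MvPowerSeries.coeff (α.sumElim β) a

lemma mixedCoeff_mul_X_inl (a : MixedSeries n) (i : Fin (n + 1)) (α β : Fin (n + 1) →₀ ℕ) :
    mixedCoeff (a * MvPowerSeries.X (Sum.inl i)) α β =
      if Finsupp.single i 1 ≤ α then mixedCoeff a (α - Finsupp.single i 1) β else 0 := by
  have hle : (Finsupp.single (Sum.inl i) 1 ≤ α.sumElim β) ↔ Finsupp.single i 1 ≤ α := by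
    rw [Finsupp.single_le_iff, Finsupp.single_le_iff, Finsupp.sumElim_inl]
  rw [mixedCoeff, MvPowerSeries.X, MvPowerSeries.coeff_mul_monomial, mul_one]
  simp only [hle]
  rw [mixedCoeff, show α.sumElim β - Finsupp.single (Sum.inl i) 1
    = (α - Finsupp.single i 1).sumElim β by ext (j | j) <;> simp [Finsupp.single_apply]]

lemma mixedCoeff_mul_X_inr (a : MixedSeries n) (i : Fin (n + 1)) (α β : Fin (n + 1) →₀ ℕ) :
    mixedCoeff (a * MvPowerSeries.X (Sum.inr i)) α β =
      if Finsupp.single i 1 ≤ β then mixedCoeff a α (β - Finsupp.single i 1) else 0 := by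
  have hle : (Finsupp.single (Sum.inr i) 1 ≤ α.sumElim β) ↔ Finsupp.single i 1 ≤ β := by
    rw [Finsupp.single_le_iff, Finsupp.single_le_iff, Finsupp.sumElim_inr]
  rw [mixedCoeff, MvPowerSeries.X, MvPowerSeries.coeff_mul_monomial, mul_one]
  simp only [hle]
  rw [mixedCoeff, show α.sumElim β - Finsupp.single (Sum.inr i) 1
    = α.sumElim (β - Finsupp.single i 1) by ext (j | j) <;> simp [Finsupp.single_apply]]

lemma mixedCoeff_mul_defining (ℓ : ℕ) (a : MixedSeries n) (α β : Fin (n + 1) →₀ ℕ) :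
    mixedCoeff (a * defining ℓ (fun i : Fin (n + 1) => (MvPowerSeries.X i : Series n))) α β
      = modelCoeff (1 / (2 * Complex.I)) (fun j => ((sgn ℓ j : ℝ) : ℂ)) (mixedCoeff a) α β := by
  have h1 : a * defining ℓ (fun i : Fin (n + 1) => (MvPowerSeries.X i : Series n))
      = MvPowerSeries.C (1 / (2 * Complex.I)) * (a * MvPowerSeries.X (Sum.inl (Fin.last n))
          - a * MvPowerSeries.X (Sum.inr (Fin.last n)))
        - ∑ j : Fin n, MvPowerSeries.C ((sgn ℓ j : ℝ) : ℂ)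
          * (a * MvPowerSeries.X (Sum.inl j.castSucc) * MvPowerSeries.X (Sum.inr j.castSucc)) := by
    simp only [defining, hol_X, conjHol_X]
    rw [mul_sub, Finset.mul_sum]
    congr 1
    · ring
    · exact Finset.sum_congr rfl fun j _ => by ring
  have h2 : ∀ c : ℂ, ∀ b : MixedSeries n, MvPowerSeries.coeff (α.sumElim β)
      (MvPowerSeries.C c * b) = c * mixedCoeff b α β := fun c b => MvPowerSeries.coeff_C_mul _ _ _
  have h3 : ∀ b b' : MixedSeries n, mixedCoeff (b - b') α β = mixedCoeff b α β - mixedCoeff b' α β :=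
    fun b b' => map_sub _ _ _
  rw [h1, mixedCoeff, map_sub, map_sum, modelCoeff]
  simp only [h2, h3]
  congr 1
  · rw [mixedCoeff_mul_X_inl, mixedCoeff_mul_X_inr]
  · refine Finset.sum_congr rfl fun j _ => ?_
    rw [mixedCoeff_mul_X_inr, mixedCoeff_mul_X_inl]
    simp only [and_comm (a := Finsupp.single j.castSucc 1 ≤ α), ite_and]

/-- The form, evaluated at a formal map in homogeneous coordinates. -/
noncomputable def formSeries {N : ℕ} (ℓ : ℕ) (Φ : Option (Fin (N + 1)) → Series n) :
    MixedSeries n :=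
  MvPowerSeries.C (1 / (2 * Complex.I)) * (hol (Φ (some (Fin.last N))) * conjHol (Φ none)
      - hol (Φ none) * conjHol (Φ (some (Fin.last N))))
    - ∑ j : Fin N, MvPowerSeries.C ((sgn ℓ j : ℝ) : ℂ)
        * (hol (Φ (some j.castSucc)) * conjHol (Φ (some j.castSucc)))

lemma formSeries_eq_defining {N : ℕ} (ℓ : ℕ) (H : Fin (N + 1) → Series n) :
    formSeries ℓ (fun i => i.elim 1 H) = defining ℓ H := by
  simp only [formSeries, defining, Option.elim, hol_one, conjHol_one, mul_one, one_mul]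

/-- Homogeneous coordinates may be rescaled by a series μ; this multiplies the factor a by μ(Z)
μ̄(Z̄), which is the freedom used to normalize a(Z, 0). -/
lemma formSeries_mul {N : ℕ} (ℓ : ℕ) (μ : Series n) (Φ : Option (Fin (N + 1)) → Series n) :
    formSeries ℓ (fun i => μ * Φ i) = hol μ * conjHol μ * formSeries ℓ Φ := by
  simp only [formSeries, hol_mul, conjHol_mul]
  rw [mul_sub (hol μ * conjHol μ), Finset.mul_sum]
  congr 1
  · ring
  · exact Finset.sum_congr rfl fun j _ => by ring

/-- The vector of coefficients of a given exponent. -/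
noncomputable def coeffVec {N : ℕ} (Φ : Option (Fin (N + 1)) → Series n) (α : Fin (n + 1) →₀ ℕ) :
    Option (Fin (N + 1)) → ℂ := fun i => MvPowerSeries.coeff α (Φ i)

lemma mixedCoeff_formSeries {N : ℕ} (ℓ : ℕ) (Φ : Option (Fin (N + 1)) → Series n)
    (α β : Fin (n + 1) →₀ ℕ) :
    mixedCoeff (formSeries ℓ Φ) α β = form ℓ (coeffVec Φ α) (coeffVec Φ β) := by
  rw [mixedCoeff, formSeries, map_sub, map_sum, MvPowerSeries.coeff_C_mul, map_sub]
  simp only [MvPowerSeries.coeff_C_mul, coeff_hol_mul_conjHol]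
  rfl

/-- The restriction of a series in `(Z, Z̄)` to `Z̄ = 0`. -/
noncomputable def restrict (a : MixedSeries n) : Series n :=
  MvPowerSeries.killCompl Function.Embedding.inl a

lemma coeff_restrict (a : MixedSeries n) (α : Fin (n + 1) →₀ ℕ) :
    MvPowerSeries.coeff α (restrict a) = mixedCoeff a α 0 := by
  rw [restrict, MvPowerSeries.coeff_killCompl, Finsupp.embDomain_inl, mixedCoeff]

lemma restrict_mul_hol_mul_conjHol (a : MixedSeries n) (μ : Series n) :
    restrict (a * (hol μ * conjHol μ))
      = restrict a * (μ * MvPowerSeries.C (star (MvPowerSeries.constantCoeff μ))) := by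
  have h1 : restrict (hol μ) = μ := by
    ext α
    rw [coeff_restrict, mixedCoeff, coeff_hol, if_pos rfl]
  have h2 : restrict (conjHol μ) = MvPowerSeries.C (star (MvPowerSeries.constantCoeff μ)) := by
    ext α
    rw [coeff_restrict, mixedCoeff, coeff_conjHol, MvPowerSeries.coeff_C]
    rfl
  have h3 : ∀ b b' : MixedSeries n, restrict (b * b') = restrict b * restrict b' := fun _ _ =>
    map_mul _ _ _
  rw [h3, h3, h1, h2]

/-- Transfers a sign ε from the factor A to the defining function, so that the negative case is also
governed by a factor equal to 1 on Z̄ = 0. -/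
lemma modelCoeff_smul (ε : ℂ) (hε : ε * ε = 1) (c : ℂ) (s : Fin n → ℂ)
    (A : (Fin (n + 1) →₀ ℕ) → (Fin (n + 1) →₀ ℕ) → ℂ) (α β : Fin (n + 1) →₀ ℕ) :
    modelCoeff (ε * c) (fun j => ε * s j) (fun α β => ε * A α β) α β = modelCoeff c s A α β := by
  have h : ∀ (P : Prop) [Decidable P] (x : ℂ), (if P then ε * x else 0) = ε * if P then x else 0 :=
    fun P _ x => by rw [mul_ite, mul_zero]
  simp only [modelCoeff, h, ← mul_sub]
  rw [show ∀ x : ℂ, ε * c * (ε * x) = ε * ε * (c * x) by intro x; ring, hε, one_mul]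
  congr 1
  refine Finset.sum_congr rfl fun j _ => ?_
  rw [show ∀ x : ℂ, ε * s j * (ε * x) = ε * ε * (s j * x) by intro x; ring, hε, one_mul]

end mixed

/-! ### Normalization of the 1-jet by a unitary matrix -/

section normalization

open Finsupp

variable {n k ℓ : ℕ}

lemma modelCoeff_zero_right (c : ℂ) (s : Fin n → ℂ)
    (A : (Fin (n + 1) →₀ ℕ) → (Fin (n + 1) →₀ ℕ) → ℂ) (α : Fin (n + 1) →₀ ℕ) :
    modelCoeff c s A α 0 = c * if single (Fin.last n) 1 ≤ α then
      A (α - single (Fin.last n) 1) 0 else 0 := by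
  simp [modelCoeff]

lemma modelCoeff_zero_left (c : ℂ) (s : Fin n → ℂ)
    (A : (Fin (n + 1) →₀ ℕ) → (Fin (n + 1) →₀ ℕ) → ℂ) (β : Fin (n + 1) →₀ ℕ) :
    modelCoeff c s A 0 β = -(c * if single (Fin.last n) 1 ≤ β then
      A 0 (β - single (Fin.last n) 1) else 0) := by
  simp [modelCoeff]

lemma modelCoeff_single_single (c : ℂ) (s : Fin n → ℂ)
    (A : (Fin (n + 1) →₀ ℕ) → (Fin (n + 1) →₀ ℕ) → ℂ) (i j : Fin n) :
    modelCoeff c s A (single i.castSucc 1) (single j.castSucc 1)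
      = -(if i = j then s i * A 0 0 else 0) := by
  simp only [modelCoeff, IsNormalized.single_le_single, (Fin.castSucc_lt_last _).ne', if_false,
    sub_self, mul_zero, zero_sub, neg_inj, Fin.castSucc_inj]
  rw [Finset.sum_eq_single i]
  · split_ifs with h1 h2 h2
    · simp [h2]
    · exact absurd h1.2 h2
    · exact absurd ⟨rfl, h2⟩ h1
    · simp
  · intro b _ hb
    simp [hb]
  · simp

lemma modelCoeff_last_single (c : ℂ) (s : Fin n → ℂ)
    (A : (Fin (n + 1) →₀ ℕ) → (Fin (n + 1) →₀ ℕ) → ℂ) (j : Fin n) :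
    modelCoeff c s A (single (Fin.last n) 1) (single j.castSucc 1)
      = c * A 0 (single j.castSucc 1) := by
  simp [modelCoeff, (Fin.castSucc_lt_last _).ne,
    (Fin.castSucc_lt_last _).ne']

lemma modelCoeff_last_last (c : ℂ) (s : Fin n → ℂ)
    (A : (Fin (n + 1) →₀ ℕ) → (Fin (n + 1) →₀ ℕ) → ℂ) :
    modelCoeff c s A (single (Fin.last n) 1) (single (Fin.last n) 1)
      = c * (A 0 (single (Fin.last n) 1) - A (single (Fin.last n) 1) 0) := by
  simp [modelCoeff, (Fin.castSucc_lt_last _).ne]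

/-- The coefficients of the linear map `(z, w) ↦ (z ∘ σ, 0, ε w)` in homogeneous coordinates. -/
noncomputable def linearCoeff (k : ℕ) (ε : ℝ) (σ : Equiv.Perm (Fin n)) (α : Fin (n + 1) →₀ ℕ) :
    Option (Fin (n + k + 1)) → ℂ := fun i =>
  i.elim (if α = 0 then 1 else 0)
    (Fin.lastCases (if α = single (Fin.last n) 1 then (ε : ℂ) else 0)
      (Fin.addCases (fun m => if α = single (σ m).castSucc 1 then 1 else 0) fun _ => 0))

/-- Coefficient vectors of a formal map between hyperquadrics, scaled so that the factor in its
equation is `1` on `Z̄ = 0`, are carried by a unitary matrix to those of a linear map. -/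
theorem exists_isUnitary_mulVec_eq_linearCoeff (hℓ : ℓ ≤ n) (hn : 0 < n)
    (hsum : ∑ j : Fin n, sgn ℓ j = 0)
    {v : (Fin (n + 1) →₀ ℕ) → Option (Fin (n + k + 1)) → ℂ}
    {A : (Fin (n + 1) →₀ ℕ) → (Fin (n + 1) →₀ ℕ) → ℂ} {ε : ℝ} (hε : ε * ε = 1)
    {σ : Equiv.Perm (Fin n)} (hσ : ∀ m, sgn ℓ (σ m) = ε * sgn ℓ m)
    (hv : ∀ α β, form ℓ (v α) (v β) =
      modelCoeff (ε * (1 / (2 * Complex.I))) (fun j => (ε : ℂ) * (sgn ℓ j : ℝ)) A α β)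
    (hA : ∀ α, A α 0 = if α = 0 then 1 else 0) :
    ∃ U : Matrix (Option (Fin (n + k + 1))) (Option (Fin (n + k + 1))) ℂ, IsUnitary ℓ U ∧
      ∀ α, U.mulVec (v α) = linearCoeff k ε σ α := by
  have hεC : (ε : ℂ) * ε = 1 := by exact_mod_cast hε
  have hε0 : (ε : ℂ) ≠ 0 := left_ne_zero_of_mul_eq_one hεC
  have hεs : star (ε : ℂ) = ε := Complex.conj_ofReal ε
  have hc0 : (ε : ℂ) * (1 / (2 * Complex.I)) ≠ 0 := mul_ne_zero hε0 half_I_ne_zero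
  have hr : ∀ α, form ℓ (v α) (v 0) =
      ε * (1 / (2 * Complex.I)) * if α = single (Fin.last n) 1 then 1 else 0 := by
    intro α
    rw [hv, modelCoeff_zero_right]
    congr 1
    by_cases h : single (Fin.last n) 1 ≤ α
    · rw [if_pos h, hA]
      congr 1
      rw [tsub_eq_zero_iff_le]
      exact propext ⟨fun h3 => le_antisymm h3 h, fun h3 => h3.le⟩
    · rw [if_neg h, if_neg]
      rintro rfl
      exact h le_rfl
  have hl : ∀ α, form ℓ (v 0) (v α) =
      -(ε * (1 / (2 * Complex.I)) * if α = single (Fin.last n) 1 then 1 else 0) := by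
    intro α
    rw [← star_form, hr, star_mul', star_mul', star_half_I, hεs]
    split_ifs <;> simp
  -- Hermitian symmetry of the form transfers the normalization of A from Z̄ = 0 to Z = 0.
  have hA' : ∀ β, A 0 β = if β = 0 then 1 else 0 := by
    intro β
    have h1 := hl (β + single (Fin.last n) 1)
    rw [hv, modelCoeff_zero_left, if_pos le_add_self, add_tsub_cancel_right, neg_inj] at h1
    rw [mul_left_cancel₀ hc0 h1]
    simp only [add_eq_right]
  have hs0 : ∀ i : Fin (n + 1), (single i 1 : Fin (n + 1) →₀ ℕ) ≠ 0 := by simp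
  have hww : form ℓ (v (single (Fin.last n) 1)) (v (single (Fin.last n) 1)) = 0 := by
    rw [hv, modelCoeff_last_last, hA, hA', if_neg (hs0 _), sub_self, mul_zero]
  have hwz : ∀ j : Fin n, form ℓ (v (single (Fin.last n) 1)) (v (single j.castSucc 1)) = 0 := by
    intro j
    rw [hv, modelCoeff_last_single, hA', if_neg (hs0 _), mul_zero]
  have hzw : ∀ j : Fin n, form ℓ (v (single j.castSucc 1)) (v (single (Fin.last n) 1)) = 0 := by
    intro j
    rw [← star_form, hwz, star_zero]
  have hzz : ∀ i j : Fin n, form ℓ (v (single (σ i).castSucc 1)) (v (single (σ j).castSucc 1))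
      = -(if i = j then ((sgn ℓ i : ℝ) : ℂ) else 0) := by
    intro i j
    rw [hv, modelCoeff_single_single, hA, if_pos rfl, mul_one, hσ, Complex.ofReal_mul, ← mul_assoc,
      hεC, one_mul]
    simp only [σ.injective.eq_iff]
  have hzl : ∀ j : Fin n, (single j.castSucc 1 : Fin (n + 1) →₀ ℕ) ≠ single (Fin.last n) 1 := by
    intro j h
    exact (Fin.castSucc_lt_last j).ne ((Finsupp.single_left_inj one_ne_zero).1 h)
  -- The products of the v_α at the z-exponents carry the signs ε · sgn, and σ rearranges them into
  -- the signs sgn. The factor ε on the w-vector corrects its pairing with v 0.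
  let b : Option (Fin (n + 1)) → Option (Fin (n + k + 1)) → ℂ := fun i => i.elim (v 0)
    (Fin.lastCases ((ε : ℂ) • v (single (Fin.last n) 1)) fun m => v (single (σ m).castSucc 1))
  have hb0 : b none = v 0 := rfl
  have hbl : b (some (Fin.last n)) = (ε : ℂ) • v (single (Fin.last n) 1) :=
    Fin.lastCases_last (motive := fun _ => _)
  have hbz : ∀ m : Fin n, b (some m.castSucc) = v (single (σ m).castSucc 1) := fun m =>
    Fin.lastCases_castSucc (motive := fun _ => _) m
  have hb : IsFrame ℓ b := by
    intro i i'
    rcases i' with _ | i'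
    · rw [form_single_none, hb0]
      rcases i with _ | i
      · rw [hb0, hr, if_neg (hs0 _).symm]
        simp
      · induction i using Fin.lastCases with
        | last =>
          rw [hbl, form_smul_left, hr, if_pos rfl, mul_one, ← mul_assoc, hεC]
          simp
        | cast i =>
          rw [hbz, hr, if_neg (hzl _)]
          simp [(Fin.castSucc_lt_last _).ne']
    · induction i' using Fin.lastCases with
      | last =>
        rw [form_single_last, hbl, form_smul_right, hεs]
        rcases i with _ | i
        · rw [hb0, hl, if_pos rfl, mul_one, mul_neg, ← mul_assoc, hεC]
          simp
        · induction i using Fin.lastCases with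
          | last => rw [hbl, form_smul_left, hww]; simp
          | cast i => rw [hbz, hzw]; simp
      | cast i' =>
        rw [form_single_castSucc, hbz]
        rcases i with _ | i
        · rw [hb0, hl, if_neg (hzl _)]
          simp
        · induction i using Fin.lastCases with
          | last => rw [hbl, form_smul_left, hwz]; simp [(Fin.castSucc_lt_last _).ne]
          | cast i =>
            rw [hbz, hzz]
            by_cases h : i = i'
            · simp [h]
            · simp [h, Ne.symm h]
  obtain ⟨U, hU, hUb⟩ := hb.exists_isUnitary hℓ
  have hU0 : U.mulVec (v 0) = Pi.single none 1 := by rw [← hb0, hUb, coordIncl_none]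
  have hUl : U.mulVec (v (single (Fin.last n) 1))
      = (ε : ℂ) • (Pi.single (some (Fin.last (n + k))) 1 : Option (Fin (n + k + 1)) → ℂ) := by
    rw [← coordIncl_last, ← hUb, hbl, Matrix.mulVec_smul, smul_smul, hεC, one_smul]
  have hUz : ∀ m : Fin n, U.mulVec (v (single (σ m).castSucc 1))
      = Pi.single (some (Fin.castAdd k m).castSucc) 1 := by
    intro m
    rw [← hbz, hUb, coordIncl_castSucc]
  have hUz' : ∀ j : Fin n, U.mulVec (v (single j.castSucc 1))
      = Pi.single (some (Fin.castAdd k (σ.symm j)).castSucc) 1 := by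
    intro j
    rw [← hUz, Equiv.apply_symm_apply]
  have hq : ∀ α, U.mulVec (v α) (some (Fin.last (n + k)))
      = if α = single (Fin.last n) 1 then (ε : ℂ) else 0 := by
    intro α
    have h1 := hr α
    rw [← hU, hU0, form_single_none, mul_assoc, mul_left_comm] at h1
    rw [mul_left_cancel₀ half_I_ne_zero h1, mul_ite, mul_one, mul_zero]
  -- Indexing by `σ.symm` makes the j-th tangential component start with z_j. The indices beyond n ≥
  -- ℓ all have sign +1, so the normal components enter the equation as plain squares.
  have hnorm : IsNormalized (ε * (1 / (2 * Complex.I))) (fun j : Fin n => (ε : ℂ) * (sgn ℓ j : ℝ))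
      (fun α => U.mulVec (v α) none) (fun α => ε * U.mulVec (v α) (some (Fin.last (n + k))))
      (fun j α => U.mulVec (v α) (some (Fin.castAdd k (σ.symm j)).castSucc))
      (fun (i : Fin k) α => U.mulVec (v α) (some (Fin.natAdd n i).castSucc)) A := by
    refine ⟨hc0, fun j => mul_ne_zero hε0 (by simpa using sgn_ne_zero ℓ j), ?_, ?_, ?_, ?_, ?_, ?_,
      ?_, ?_, ?_⟩
    · rw [← Finset.mul_sum, ← Complex.ofReal_sum, hsum, Complex.ofReal_zero, mul_zero]
    · intro α
      rw [hq]
      split_ifs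
      · exact hεC
      · simp
    · rw [hU0]; simp
    · intro i
      induction i using Fin.lastCases with
      | last => rw [hUl]; simp
      | cast j => rw [hUz']; simp
    · intro j
      rw [hU0]; simp
    · intro j i
      induction i using Fin.lastCases with
      | last => rw [hUl, if_neg (Fin.castSucc_lt_last j).ne']; simp [(Fin.castSucc_lt_last _).ne]
      | cast i =>
        rw [hUz']
        by_cases h : i = j
        · simp [h]
        · simp [Fin.ext_iff, Fin.val_ne_of_ne h, Fin.val_ne_of_ne (σ.symm.injective.ne (Ne.symm h))]
    · intro i
      rw [hU0]; simp
    · intro i j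
      induction j using Fin.lastCases with
      | last =>
        rw [hUl, ← coordIncl_last, Pi.smul_apply,
          Pi.single_eq_of_ne (coordIncl_ne_natAdd _ _).symm, smul_zero]
      | cast j =>
        rw [hUz', ← coordIncl_castSucc, Pi.single_eq_of_ne (coordIncl_ne_natAdd _ _).symm]
    · intro α β
      rw [← hv, ← hU, form, Fin.sum_univ_add, sub_sub]
      congr 1
      · rw [star_mul', hεs]
        linear_combination (1 / (2 * Complex.I)) * (U.mulVec (v α) (some (Fin.last (n + k)))
          * star (U.mulVec (v β) none) - U.mulVec (v α) none
            * star (U.mulVec (v β) (some (Fin.last (n + k))))) * hεC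
      · congr 1
        · rw [← Equiv.sum_comp σ]
          refine Finset.sum_congr rfl fun m _ => ?_
          rw [hσ, Equiv.symm_apply_apply, Complex.ofReal_mul, ← mul_assoc (ε : ℂ), hεC, one_mul,
            Fin.val_castAdd]
        · refine Finset.sum_congr rfl fun i _ => ?_
          rw [sgn, if_neg (by simp; omega), Complex.ofReal_one, one_mul]
  refine ⟨U, hU, fun α => funext fun i => ?_⟩
  rcases i with _ | i
  · exact hnorm.p_eq_single hn α
  · induction i using Fin.lastCases with
    | last => exact (hq α).trans (Fin.lastCases_last (motive := fun _ => _)).symm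
    | cast i =>
      refine Eq.trans ?_ (Fin.lastCases_castSucc (motive := fun _ => _) i).symm
      induction i using Fin.addCases with
      | left m =>
        refine Eq.trans ?_ (Fin.addCases_left (motive := fun _ => _) m).symm
        have := hnorm.f_eq_single (σ m) α
        rwa [Equiv.symm_apply_apply] at this
      | right m =>
        refine Eq.trans ?_ (Fin.addCases_right (motive := fun _ => _) m).symm
        exact hnorm.φ_eq_zero hn m α

end normalization

/-! ### Transversality and reduction of an embedding to linear form -/

section embedding

open Finsupp

variable {n k ℓ : ℕ}

/-- The coefficients of the equation of a formal embedding. -/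
lemma form_coeffVec_of_eq {N : ℕ} {Φ : Option (Fin (N + 1)) → Series n} {a : MixedSeries n}
    (h : formSeries ℓ Φ = a * defining ℓ (fun i : Fin (n + 1) => (MvPowerSeries.X i : Series n)))
    (α β : Fin (n + 1) →₀ ℕ) :
    form ℓ (coeffVec Φ α) (coeffVec Φ β) =
      modelCoeff (1 / (2 * Complex.I)) (fun j => ((sgn ℓ j : ℝ) : ℂ)) (mixedCoeff a) α β := by
  rw [← mixedCoeff_formSeries, h, mixedCoeff_mul_defining]

/-- The constant term of the factor in the equation of a formal map is real. -/
lemma star_mixedCoeff_zero {N : ℕ} {v : (Fin (n + 1) →₀ ℕ) → Option (Fin (N + 1)) → ℂ}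
    {A : (Fin (n + 1) →₀ ℕ) → (Fin (n + 1) →₀ ℕ) → ℂ}
    (hv : ∀ α β, form ℓ (v α) (v β) =
      modelCoeff (1 / (2 * Complex.I)) (fun j : Fin n => ((sgn ℓ j : ℝ) : ℂ)) A α β) :
    star (A 0 0) = A 0 0 := by
  have h1 := hv (single (Fin.last n) 1) 0
  have h2 := hv 0 (single (Fin.last n) 1)
  rw [modelCoeff_zero_right, if_pos le_rfl, tsub_self] at h1
  rw [modelCoeff_zero_left, if_pos le_rfl, tsub_self, ← star_form, h1, star_mul', star_half_I,
    neg_mul, neg_inj] at h2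
  exact mul_left_cancel₀ half_I_ne_zero h2

/-- A formal embedding between hyperquadrics of the same signature, smaller than the dimension of
the source, is transversal. -/
lemma IsFormalEmbedding.mixedCoeff_ne_zero {N : ℕ} (hℓ : ℓ < n) (hN : ℓ ≤ N)
    {H : Fin (N + 1) → Series n} (hH : IsFormalEmbedding ℓ ℓ H) {a : MixedSeries n}
    (ha : formSeries ℓ (fun i => i.elim 1 H)
      = a * defining ℓ (fun i : Fin (n + 1) => (MvPowerSeries.X i : Series n))) :
    mixedCoeff a 0 0 ≠ 0 := by
  intro h0
  have hv := form_coeffVec_of_eq ha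
  set v := coeffVec fun i : Option (Fin (N + 1)) => i.elim 1 H with hvdef
  have hz : ∀ j : Fin n, v (single j.castSucc 1) none = 0 := by
    intro j
    change MvPowerSeries.coeff (single j.castSucc 1) (1 : Series n) = 0
    rw [MvPowerSeries.coeff_one, if_neg (by simp)]
  have hv0 : v 0 = Pi.single none 1 := by
    funext i
    rcases i with _ | i
    · change MvPowerSeries.coeff 0 (1 : Series n) = _
      simp
    · exact (hH.map_zero i).trans (by simp)
  have hlast : ∀ j : Fin n, v (single j.castSucc 1) (some (Fin.last N)) = 0 := by
    intro j
    have h1 := hv (single j.castSucc 1) 0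
    rw [modelCoeff_zero_right, if_neg, mul_zero, hv0, form_single_none] at h1
    · exact (mul_eq_zero.1 h1).resolve_left half_I_ne_zero
    · rw [IsNormalized.single_le_single]
      exact (Fin.castSucc_lt_last j).ne'
  -- If a(0, 0) = 0, the n tangential first derivatives span a totally isotropic space. As n > ℓ,
  -- some nontrivial combination has its first ℓ coordinates zero; there the form is definite, so
  -- the combination vanishes and contradicts the rank of the Jacobian.
  let Y : (Fin n → ℂ) →ₗ[ℂ] (Option (Fin (N + 1)) → ℂ) :=
    Fintype.linearCombination ℂ fun j : Fin n => v (single j.castSucc 1)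
  let Λ : (Option (Fin (N + 1)) → ℂ) →ₗ[ℂ] (Fin ℓ → ℂ) :=
    LinearMap.pi fun m => LinearMap.proj (some (Fin.castLE hN m).castSucc)
  obtain ⟨x, hx, hx0⟩ := (Submodule.ne_bot_iff _).1
    (LinearMap.ker_ne_bot_of_finrank_lt (f := Λ ∘ₗ Y) (by simpa using hℓ))
  rw [LinearMap.mem_ker, LinearMap.comp_apply] at hx
  have hY : Y x = ∑ j, x j • v (single j.castSucc 1) := Fintype.linearCombination_apply ℂ _ x
  have hform : form ℓ (Y x) (Y x) = 0 := by
    rw [hY, form_sum_left]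
    refine Finset.sum_eq_zero fun i _ => ?_
    rw [form_sum_right, Finset.sum_eq_zero, mul_zero]
    intro j _
    rw [hv, modelCoeff_single_single, h0]
    simp
  have hYn : Y x none = 0 := by
    rw [hY, Finset.sum_apply]
    exact Finset.sum_eq_zero fun j _ => by rw [Pi.smul_apply, hz, smul_zero]
  have hYl : Y x (some (Fin.last N)) = 0 := by
    rw [hY, Finset.sum_apply]
    exact Finset.sum_eq_zero fun j _ => by rw [Pi.smul_apply, hlast, smul_zero]
  have h1 := form_self_of_isotropic_part (ℓ := ℓ) (y := Y x) (by rw [hYn, hYl, mul_zero])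
    fun j hj => congrFun hx ⟨j, hj⟩
  rw [hform, hYl, norm_zero, zero_pow two_ne_zero, zero_add, Complex.zero_re, eq_comm,
    neg_eq_zero, Finset.sum_eq_zero_iff_of_nonneg (fun _ _ => by positivity)] at h1
  have hY0 : ∀ i, Y x (some i) = 0 := by
    intro i
    induction i using Fin.lastCases with
    | last => exact hYl
    | cast j => simpa using h1 j (Finset.mem_univ j)
  let x' : Fin (n + 1) → ℂ := Fin.lastCases 0 x
  have hx' : (jacobian H).mulVec x' = (jacobian H).mulVec 0 := by
    funext i
    rw [Matrix.mulVec_zero, Pi.zero_apply, ← hY0 i, hY, Finset.sum_apply, Matrix.mulVec,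
      dotProduct, Fin.sum_univ_castSucc]
    simp only [x', Fin.lastCases_last, Fin.lastCases_castSucc, mul_zero, add_zero]
    exact Finset.sum_congr rfl fun j _ => mul_comm _ _
  have := hH.injective hx'
  refine hx0 (funext fun j => ?_)
  have h2 := congrFun this j.castSucc
  simpa [x'] using h2

/-- The linear map `(z, w) ↦ (z ∘ σ, 0, ε w)`. -/
noncomputable def linearMap (k : ℕ) (ε : ℝ) (σ : Equiv.Perm (Fin n)) :
    Fin (n + k + 1) → Series n :=
  Fin.lastCases (MvPowerSeries.C (ε : ℂ) * MvPowerSeries.X (Fin.last n))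
    (Fin.addCases (fun m => MvPowerSeries.X (σ m).castSucc) fun _ => 0)

lemma coeffVec_linearMap (ε : ℝ) (σ : Equiv.Perm (Fin n)) (α : Fin (n + 1) →₀ ℕ) :
    coeffVec (fun i : Option (Fin (n + k + 1)) => i.elim 1 (linearMap k ε σ)) α
      = linearCoeff k ε σ α := by
  funext i
  rcases i with _ | i
  · simp [coeffVec, linearCoeff, MvPowerSeries.coeff_one]
  · simp only [coeffVec, linearCoeff, Option.elim, linearMap]
    induction i using Fin.lastCases with
    | last =>
      rw [Fin.lastCases_last, Fin.lastCases_last, MvPowerSeries.coeff_C_mul, MvPowerSeries.coeff_X]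
      simp
    | cast i =>
      rw [Fin.lastCases_castSucc, Fin.lastCases_castSucc]
      induction i using Fin.addCases with
      | left m => rw [Fin.addCases_left, Fin.addCases_left, MvPowerSeries.coeff_X]
      | right m => rw [Fin.addCases_right, Fin.addCases_right, map_zero]

lemma coeffVec_sum_C_mul {N : ℕ} (U : Matrix (Option (Fin (N + 1))) (Option (Fin (N + 1))) ℂ)
    (Φ : Option (Fin (N + 1)) → Series n) (α : Fin (n + 1) →₀ ℕ) :
    coeffVec (fun i => ∑ j, MvPowerSeries.C (U i j) * Φ j) α = U.mulVec (coeffVec Φ α) := by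
  funext i
  simp [coeffVec, Matrix.mulVec, dotProduct, MvPowerSeries.coeff_C_mul]

/-- A formal embedding with a given sign of the factor in its equation is equivalent to a linear
map. -/
theorem IsFormalEmbedding.exists_comp_eq_linearMap (hℓ : ℓ ≤ n) (hn : 0 < n)
    (hsum : ∑ j : Fin n, sgn ℓ j = 0)
    {H : Fin (n + k + 1) → Series n} (hH : IsFormalEmbedding ℓ ℓ H) {a : MixedSeries n}
    (ha : formSeries ℓ (fun i => i.elim 1 H)
      = a * defining ℓ (fun i : Fin (n + 1) => (MvPowerSeries.X i : Series n)))
    {ε r : ℝ} (hε : ε * ε = 1) (hr : 0 < r) (har : mixedCoeff a 0 0 = ε * r)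
    {σ : Equiv.Perm (Fin n)} (hσ : ∀ m, sgn ℓ (σ m) = ε * sgn ℓ m) :
    ∃ (T : (Fin (n + k + 1) → ℂ) → (Fin (n + k + 1) → ℂ))
      (P : Fin (n + k + 1) → Series (n + k)),
      IsAut (n + k) ℓ T ∧ IsTaylorSeries T P ∧ comp P H = linearMap k ε σ := by
  have hεC : (ε : ℂ) * ε = 1 := by exact_mod_cast hε
  have hrC : (r : ℂ) ≠ 0 := by exact_mod_cast hr.ne'
  have hsq : ((Real.sqrt r : ℝ) : ℂ) * (Real.sqrt r : ℝ) = r := by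
    exact_mod_cast Real.mul_self_sqrt hr.le
  have hs0 : ((Real.sqrt r : ℝ) : ℂ) ≠ 0 := by
    intro h
    rw [h, zero_mul] at hsq
    exact hrC hsq.symm
  set a₀ : Series n := MvPowerSeries.C (ε : ℂ) * restrict a with ha₀
  have ha₀c : MvPowerSeries.constantCoeff a₀ = r := by
    have : MvPowerSeries.constantCoeff (restrict a) = mixedCoeff a 0 0 := coeff_restrict a 0
    rw [ha₀, map_mul, this, har, MvPowerSeries.constantCoeff_C, ← mul_assoc, hεC, one_mul]
  have ha₀i : a₀ * a₀⁻¹ = 1 := MvPowerSeries.mul_inv_cancel _ (by rwa [ha₀c])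
  -- Restricted to Z̄ = 0, the new factor is a(Z, 0) μ(Z) times the conjugate of μ(0). Since μ(0) =
  -- 1/√r, the factor √r in μ makes this equal to ε.
  set μ : Series n := MvPowerSeries.C ((Real.sqrt r : ℝ) : ℂ) * a₀⁻¹ with hμ
  have hμc : MvPowerSeries.constantCoeff μ = ((Real.sqrt r : ℝ) : ℂ)⁻¹ := by
    rw [hμ, map_mul, MvPowerSeries.constantCoeff_inv, ha₀c, MvPowerSeries.constantCoeff_C, ← hsq]
    field_simp
  have hμs : star (MvPowerSeries.constantCoeff μ) = ((Real.sqrt r : ℝ) : ℂ)⁻¹ := by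
    rw [hμc, star_inv₀]
    exact congrArg _ (Complex.conj_ofReal _)
  have hμ0 : MvPowerSeries.constantCoeff μ ≠ 0 := by
    rw [hμc]
    exact inv_ne_zero hs0
  set Φ : Option (Fin (n + k + 1)) → Series n := fun i => i.elim 1 H with hΦ
  have hΨ : formSeries ℓ (fun i => μ * Φ i) = (a * (hol μ * conjHol μ))
      * defining ℓ (fun i : Fin (n + 1) => (MvPowerSeries.X i : Series n)) := by
    rw [formSeries_mul, ha]
    ring
  have hA : ∀ α, (ε : ℂ) * mixedCoeff (a * (hol μ * conjHol μ)) α 0 = if α = 0 then 1 else 0 := by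
    intro α
    have : MvPowerSeries.C (ε : ℂ) * restrict (a * (hol μ * conjHol μ)) = 1 := by
      rw [restrict_mul_hol_mul_conjHol, ← mul_assoc, ← ha₀, hμs, hμ,
        show ∀ x y z w : Series n, x * (y * z * w) = (x * z) * (y * w) by intros; ring, ha₀i,
        one_mul, ← map_mul, mul_inv_cancel₀ hs0, map_one]
    rw [← coeff_restrict, ← MvPowerSeries.coeff_C_mul, this, MvPowerSeries.coeff_one]
  obtain ⟨U, hU, hUv⟩ := exists_isUnitary_mulVec_eq_linearCoeff hℓ hn hsum hε hσ
    (fun α β => (form_coeffVec_of_eq hΨ α β).trans (modelCoeff_smul (ε : ℂ) hεC _ _ _ α β).symm) hA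
  have hser : ∀ i, ∑ j, MvPowerSeries.C (U i j) * (μ * Φ j)
      = (i.elim 1 (linearMap k ε σ) : Series n) := by
    intro i
    ext α
    have h1 := hUv α
    rw [← coeffVec_sum_C_mul, ← coeffVec_linearMap] at h1
    exact congrFun h1 i
  -- Both H and the linear map vanish at 0, so constant terms show that U fixes the line of the base
  -- point.
  have hcol : ∀ i, U (some i) none = 0 := by
    intro i
    have h2 := congrArg MvPowerSeries.constantCoeff (hser (some i))
    have h3 : MvPowerSeries.constantCoeff (linearMap k ε σ i) = 0 := by
      induction i using Fin.lastCases with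
      | last => simp [linearMap]
      | cast i =>
        rw [linearMap, Fin.lastCases_castSucc]
        induction i using Fin.addCases <;> simp
    rw [map_sum, Fintype.sum_option] at h2
    simpa [hΦ, hH.map_zero, h3, hμ0] using h2
  obtain ⟨h0, haut⟩ := hU.isAut hcol
  have hμi : μ * μ⁻¹ = 1 := MvPowerSeries.mul_inv_cancel _ hμ0
  -- Undoing the rescaling: U applied to (1 : H) is μ⁻¹ times the linear map, and the common factor
  -- disappears in affine coordinates.
  have hlam : ∀ i, MvPowerSeries.C (U i none) + ∑ m, MvPowerSeries.C (U i (some m)) * H m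
      = μ⁻¹ * (i.elim 1 (linearMap k ε σ) : Series n) := by
    intro i
    rw [← hser i, Finset.mul_sum, Fintype.sum_option]
    have : ∀ x y : Series n, μ⁻¹ * (x * (μ * y)) = x * y := by
      intro x y
      rw [show μ⁻¹ * (x * (μ * y)) = (μ * μ⁻¹) * (x * y) by ring, hμi, one_mul]
    simp only [this, hΦ, Option.elim]
    rw [mul_one]
  refine ⟨projMap U, projSeries U, haut, isTaylorSeries_projSeries h0, ?_⟩
  refine comp_projSeries_eq hH.map_zero h0 μ⁻¹ ?_ fun i => hlam (some i)
  have := hlam none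
  rwa [Option.elim, mul_one] at this

/-! ### The balance of signs and the two linear models -/

lemma sum_sgn_half {ℓ n : ℕ} (h : n = ℓ + ℓ) : ∑ j : Fin n, sgn ℓ j = 0 := by
  subst h
  rw [Fin.sum_univ_add]
  simp [sgn]

/-- The exchange of the two halves of the coordinates `z`. -/
def exchange {ℓ n : ℕ} (h : n = ℓ + ℓ) (j : Fin n) : Fin n :=
  if hj : (j : ℕ) < ℓ then ⟨j + ℓ, by omega⟩ else ⟨j - ℓ, by omega⟩

lemma exchange_of_lt {ℓ n : ℕ} (h : n = ℓ + ℓ) {j : Fin n} (hj : (j : ℕ) < ℓ) :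
    (exchange h j : ℕ) = j + ℓ := by
  rw [exchange, dif_pos hj]

lemma exchange_of_le {ℓ n : ℕ} (h : n = ℓ + ℓ) {j : Fin n} (hj : ℓ ≤ j) :
    (exchange h j : ℕ) = j - ℓ := by
  rw [exchange, dif_neg (not_lt.2 hj)]

lemma exchange_involutive {ℓ n : ℕ} (h : n = ℓ + ℓ) : Function.Involutive (exchange h) := by
  intro j
  ext
  have := j.2
  rcases lt_or_ge (j : ℕ) ℓ with hj | hj
  · have h1 := exchange_of_lt h hj
    rw [exchange_of_le h (by omega), h1]
    omega
  · have h1 := exchange_of_le h hj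
    rw [exchange_of_lt h (by omega), h1]
    omega

/-- The exchange of the two halves of the coordinates `z`, as a permutation. -/
def swapHalves {ℓ n : ℕ} (h : n = ℓ + ℓ) : Equiv.Perm (Fin n) :=
  (exchange_involutive h).toPerm

lemma swapHalves_of_lt {ℓ n : ℕ} (h : n = ℓ + ℓ) {j : Fin n} (hj : (j : ℕ) < ℓ) :
    (swapHalves h j : ℕ) = j + ℓ := exchange_of_lt h hj

lemma swapHalves_of_le {ℓ n : ℕ} (h : n = ℓ + ℓ) {j : Fin n} (hj : ℓ ≤ j) :
    (swapHalves h j : ℕ) = j - ℓ := exchange_of_le h hj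

lemma linearMap_one (n k : ℕ) : linearMap k 1 (Equiv.refl (Fin n)) = linL n k := by
  funext i
  induction i using Fin.lastCases with
  | last => simp [linearMap, linL]
  | cast i =>
    rw [linearMap, linL, Fin.lastCases_castSucc, Fin.snoc_castSucc]
    induction i using Fin.addCases with
    | left m => rw [Fin.addCases_left, dif_pos (by simp)]; rfl
    | right m => rw [Fin.addCases_right, dif_neg (by simp)]

lemma linearMap_neg_one (n k : ℕ) (h : n = n / 2 + n / 2) :
    linearMap k (-1) (swapHalves h) = linLminus n k := by
  funext i
  induction i using Fin.lastCases with
  | last => simp [linearMap, linLminus]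
  | cast i =>
    rw [linearMap, linLminus, Fin.lastCases_castSucc, Fin.snoc_castSucc]
    induction i using Fin.addCases with
    | left m =>
      rw [Fin.addCases_left]
      by_cases hm : (m : ℕ) < n / 2
      · rw [dif_pos (by simpa using hm)]
        congr 2
        ext
        simp [swapHalves_of_lt h hm]
      · rw [dif_neg (by simpa using hm), dif_pos (by simp)]
        congr 2
        ext
        simp [swapHalves_of_le h (not_lt.1 hm)]
    | right m =>
      rw [Fin.addCases_right, dif_neg (by simp; omega), dif_neg (by simp)]

end embedding

end Quadric

/-! ### The theorem: two cases, by the sign of a(0, 0) -/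

theorem theorem1p7 (n k : ℕ) (hn : Even n) (hk : k < n)
    (H : Fin (n + k + 1) → Quadric.Series n)
    (hH : Quadric.IsFormalEmbedding (n / 2) (n / 2) H) :
    ∃ (T : (Fin (n + k + 1) → ℂ) → (Fin (n + k + 1) → ℂ))
      (P : Fin (n + k + 1) → Quadric.Series (n + k)),
      Quadric.IsAut (n + k) (n / 2) T ∧ Quadric.IsTaylorSeries T P ∧
        (Quadric.comp P H = Quadric.linL n k ∨ Quadric.comp P H = Quadric.linLminus n k) := by
  have h2 : n = n / 2 + n / 2 := by
    obtain ⟨m, hm⟩ := hn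
    omega
  have hn0 : 0 < n := by omega
  obtain ⟨a, ha⟩ := hH.maps_quadric
  rw [mul_comm, ← Quadric.formSeries_eq_defining] at ha
  have hreal := Quadric.star_mixedCoeff_zero (Quadric.form_coeffVec_of_eq ha)
  have hne := hH.mixedCoeff_ne_zero (by omega) (by omega) ha
  obtain ⟨x, hx⟩ : ∃ x : ℝ, Quadric.mixedCoeff a 0 0 = x :=
    ⟨_, (Complex.conj_eq_iff_re.1 hreal).symm⟩
  have hx0 : x ≠ 0 := by
    rintro rfl
    exact hne (by rw [hx, Complex.ofReal_zero])
  have hsum := Quadric.sum_sgn_half h2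
  rcases hx0.lt_or_gt with hneg | hpos
  -- For a(0, 0) < 0 the map reverses the side of the quadric. The exchange of halves reverses every
  -- sign because the two halves have the same size, and this leads to L₋.
  · obtain ⟨T, P, hT, hP, hc⟩ := hH.exists_comp_eq_linearMap (Nat.div_le_self n 2) hn0 hsum ha
      (ε := -1) (r := -x) (by norm_num) (neg_pos.2 hneg) (by rw [hx]; push_cast; ring)
      (σ := Quadric.swapHalves h2) (by
        intro m
        unfold Quadric.sgn
        by_cases hm : (m : ℕ) < n / 2
        · rw [Quadric.swapHalves_of_lt h2 hm, if_pos hm, if_neg (by omega)]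
          norm_num
        · rw [Quadric.swapHalves_of_le h2 (not_lt.1 hm), if_neg hm, if_pos (by omega)]
          norm_num)
    exact ⟨T, P, hT, hP, Or.inr (hc.trans (Quadric.linearMap_neg_one n k h2))⟩
  · obtain ⟨T, P, hT, hP, hc⟩ := hH.exists_comp_eq_linearMap (Nat.div_le_self n 2) hn0 hsum ha
      (ε := 1) (r := x) (by norm_num) hpos (by rw [hx]; push_cast; ring)
      (σ := Equiv.refl _) (fun m => by rw [one_mul]; rfl)
    exact ⟨T, P, hT, hP, Or.inl (hc.trans (Quadric.linearMap_one n k))⟩
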